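/- Let $b\ge 1$ be an integer and $r=b/(2b+1)$. Let $G_0$ be the graph with vertices $V_0=\{q_1,q_2\}$ and one edge, and let the multigraph $G_{\ell+1}$ (vertex set $V_{\ell+1}\supset V_\ell$) arise from $G_\ell$ by replacing every edge $\{x,y\}$ by two new vertices $p_1,p_2$, one edge from $x$ to $p_1$, $b$ parallel edges from $p_1$ to $p_2$, and one edge from $p_2$ to $y$. Put $V_*=\bigcup_\ell V_\ell$. Thus $G_{\ell+1}$ consists of $b+2$ copies of $G_\ell$; let $F_i:V_*\to V_*$ ($1\le i\le b+2$) be the corresponding gluing maps, normalized so that $F_{b+1}$ sends $(q_1,q_2)$ to $(q_1,p_1)$, $F_{b+2}$ sends it to $(p_2,q_2)$, and $F_1,\dots,F_b$ send it to $(p_1,p_2)$, where $p_1,p_2$ are the new vertices of $G_1$. For $f:V_*\to\mathbb R$ let $\mathcal E_\ell(f)=r^{-\ell}\sum_{\{p,q\}}|f(p)-f(q)|^2$, the sum being over all edges of $G_\ell$ (with multiplicity, each counted once), let $\mathcal E(f)=\lim_\ell \mathcal E_\ell(f)$, let $\operatorname{dom}\mathcal E=\{f:\mathcal E(f)<\infty\}$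 and $\mathcal E(f,g)=\frac14(\mathcal E(f+g)-\mathcal E(f-g))$. Let $R(p,q)$ be the least $R$ with $|f(p)-f(q)|^2\le R\,\mathcal E(f)$ for all $f\in\operatorname{dom}\mathcal E$, and let $K_b$ be the completion of $(V_*,R)$; the $F_i$ extend continuously to $K_b$, and functions in $\operatorname{dom}\mathcal E$ are identified with their continuous extensions to $K_b$. Let $\mu$ be the self-similar probability measure on $K_b$, $\mu(A)=\frac1{b+2}\sum_{i=1}^{b+2}\mu(F_i^{-1}A)$. For $f\in\operatorname{dom}\mathcal E$ and $h$ continuous on $K_b$, say that $f\in\operatorname{dom}\Delta$ with $\Delta f=h$ if $\mathcal E(f,g)=-\int_{K_b}hg\,d\mu$ for all $g\in\operatorname{dom}\mathcal E$ with $g(q_1)=g(q_2)=0$. Let $$\Delta_m f(p)=\frac1{\deg_m(p)}\sum_{q\sim p}f(q)-f(p),\qquad p\in V_m,$$ where the sum is over all edges $\{p,q\}$ of $G_m$ at $p$ (with multiplicity) and $\deg_m(p)$ is their number. **(a)** If $f\in\operatorname{dom}\Delta$, then for every $p\in V_*\setminus V_0$ $$\Delta f(p)=\frac{2}{b+1}\lim_{m\to\infty}\Big(\frac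 r{b+2}\Big)^{-m}\deg_m(p)\,\Delta_m f(p),\qquad (1)$$ where $\deg_m(p)\,\Delta_mf(p)=\sum_{q\sim p}(f(q)-f(p))$. (As $\deg_m(p)=b+1$ whenever $p\in V_m\setminus V_0$, this is $2\lim_{m\to\infty}(r/(b+2))^{-m}\Delta_mf(p)$.) **(b)** Conversely, let $f$ and $h$ be continuous functions on $K_b$ such that the right-hand side of (1) converges to $h$ uniformly on $V_*\setminus V_0$: for every $\varepsilon>0$ there is $M$ such that for all $m\ge M$ and all $p\in V_m\setminus V_0$ $$\Big|\frac{2}{b+1}\Big(\frac r{b+2}\Big)^{-m}\deg_m(p)\,\Delta_mf(p)-h(p)\Big|<\varepsilon .$$ Then $f\in\operatorname{dom}\Delta$ and $\Delta f=h$ (so that (1) holds). **(c)** If $f\in\operatorname{dom}\Delta$ and $1\le i\le b+2$, then $f\circ F_i\in\operatorname{dom}\Delta$ and $\Delta(f\circ F_i)=\dfrac{r}{b+2}\,(\Delta f)\circ F_i$. -/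

import Mathlib

open Filter Topology MeasureTheory

namespace BubbleDiamond

/-! ### Vertices, cells and graphs -/

/-- The vertices of all bubble-diamond graphs with branching parameter `b`. The two boundary points
are `q1`, `q2`. A cell is coded by a word `w` in the letters `0, …, b + 1`; when the edge coded by
`w` (of the graph of level `w.length`) is subdivided, two new vertices are created: `p1 w`, joined
to the first endpoint of the edge, and `p2 w`, joined to its second endpoint. -/
inductive Vertex (b : ℕ) : Type
  | q1 : Vertex b
  | q2 : Vertex b
  | p1 (w : List (Fin (b + 2))) : Vertex b
  | p2 (w : List (Fin (b + 2))) : Vertex b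

open Vertex

/-- The gluing maps `F_i : V_* → V_*`. The letters `0, …, b - 1` are the `b` parallel middle
copies (which run from `p1 []` to `p2 []`), the letter `b` is the copy running from `q1` to `p1 []`
and the letter `b + 1` is the copy running from `p2 []` to `q2`. -/
def F {b : ℕ} (i : Fin (b + 2)) : Vertex b → Vertex b
  | q1 => if i.val < b then p1 [] else if i.val = b then q1 else p2 []
  | q2 => if i.val < b then p2 [] else if i.val = b then p1 [] else q2
  | p1 w => p1 (i :: w)
  | p2 w => p2 (i :: w)

/-- `F_{w 0} ∘ ⋯ ∘ F_{w (ℓ - 1)}`. -/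
def cellMap {b : ℕ} : (ℓ : ℕ) → (Fin ℓ → Fin (b + 2)) → Vertex b → Vertex b
  | 0, _ => id
  | ℓ + 1, w => fun p => F (w 0) (cellMap ℓ (Fin.tail w) p)

/-- The vertex set `V_ℓ`. -/
def V (b : ℕ) : ℕ → Set (Vertex b)
  | 0 => {q1, q2}
  | ℓ + 1 => ⋃ i : Fin (b + 2), F i '' V b ℓ

/-- The edges of the multigraph `G_ℓ` are the words of length `ℓ`: each edge is a copy of the single
edge of `G_0`. -/
abbrev Edge (b ℓ : ℕ) : Type := Fin ℓ → Fin (b + 2)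

/-- First endpoint of an edge. -/
def src {b ℓ : ℕ} (e : Edge b ℓ) : Vertex b := cellMap ℓ e q1

/-- Second endpoint of an edge. -/
def tgt {b ℓ : ℕ} (e : Edge b ℓ) : Vertex b := cellMap ℓ e q2

theorem cellMap_snoc {b : ℕ} (ℓ : ℕ) (w : Fin (ℓ + 1) → Fin (b + 2)) (p : Vertex b) :
    cellMap (ℓ + 1) w p = cellMap ℓ (fun k => w k.castSucc) (F (w (Fin.last ℓ)) p) := by
  induction ℓ with
  | zero => rfl
  | succ n ih =>
    change F (w 0) (cellMap (n + 1) (Fin.tail w) p) = _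
    rw [ih]
    rfl

theorem cellMap_p1 {b : ℕ} (ℓ : ℕ) (w : Fin ℓ → Fin (b + 2)) :
    cellMap ℓ w (p1 []) = p1 (List.ofFn w) := by
  induction ℓ with
  | zero => simp [cellMap]
  | succ n ih => simp [cellMap, ih, F, List.ofFn_succ, Fin.tail_def]

theorem cellMap_p2 {b : ℕ} (ℓ : ℕ) (w : Fin ℓ → Fin (b + 2)) :
    cellMap ℓ w (p2 []) = p2 (List.ofFn w) := by
  induction ℓ with
  | zero => simp [cellMap]
  | succ n ih => simp [cellMap, ih, F, List.ofFn_succ, Fin.tail_def]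

/-- `G_{ℓ+1}` arises from `G_ℓ` by edge substitution: the edge `e` is replaced by the `b + 2` edges
`e i`; `b` of them join the two new vertices, one joins the first endpoint of `e` to the first
new vertex, one joins the second new vertex to the second endpoint of `e`. -/
theorem endpoints_snoc {b ℓ : ℕ} (e : Edge b ℓ) (i : Fin (b + 2)) :
    (src (Fin.snoc e i : Edge b (ℓ + 1)), tgt (Fin.snoc e i : Edge b (ℓ + 1))) =
      if i.val < b then (p1 (List.ofFn e), p2 (List.ofFn e))
      else if i.val = b then (src e, p1 (List.ofFn e)) else (p2 (List.ofFn e), tgt e) := by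
  simp only [src, tgt, cellMap_snoc, Fin.snoc_castSucc, Fin.snoc_last, F]
  split_ifs <;> simp [cellMap_p1, cellMap_p2]

/-- `V_*` is the union of the `V_ℓ`. -/
theorem iUnion_V (b : ℕ) : ⋃ ℓ, V b ℓ = Set.univ := by
  have key : ∀ w : List (Fin (b + 2)), (p1 w ∈ ⋃ ℓ, V b ℓ) ∧ (p2 w ∈ ⋃ ℓ, V b ℓ) := by
    intro w
    induction w with
    | nil =>
      refine ⟨Set.mem_iUnion.2 ⟨1, Set.mem_iUnion.2 ⟨⟨b, by omega⟩, q2, by simp [V], ?_⟩⟩,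
        Set.mem_iUnion.2 ⟨1, Set.mem_iUnion.2 ⟨⟨b + 1, by omega⟩, q1, by simp [V], ?_⟩⟩⟩ <;>
      simp [F]
    | cons i w ih =>
      obtain ⟨h1, h2⟩ := ih
      obtain ⟨m, hm⟩ := Set.mem_iUnion.1 h1
      obtain ⟨n, hn⟩ := Set.mem_iUnion.1 h2
      exact ⟨Set.mem_iUnion.2 ⟨m + 1, Set.mem_iUnion.2 ⟨i, _, hm, rfl⟩⟩,
        Set.mem_iUnion.2 ⟨n + 1, Set.mem_iUnion.2 ⟨i, _, hn, rfl⟩⟩⟩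
  refine Set.eq_univ_of_forall fun p => ?_
  cases p with
  | q1 => exact Set.mem_iUnion.2 ⟨0, by simp [V]⟩
  | q2 => exact Set.mem_iUnion.2 ⟨0, by simp [V]⟩
  | p1 w => exact (key w).1
  | p2 w => exact (key w).2

open Classical in
/-- Degree of `p` in the multigraph `G_ℓ` (edges counted with multiplicity; there are no loops). -/
noncomputable def deg {b : ℕ} (ℓ : ℕ) (p : Vertex b) : ℕ :=
  ∑ e : Edge b ℓ, ((if src e = p then 1 else 0) + (if tgt e = p then 1 else 0))

open Classical in
/-- The graph Laplacian `Δ_ℓ f(p) = (1 / deg p) ∑_{p ∼ q} f(q) - f(p)`, the sum being over all edges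
of `G_ℓ` at `p`. -/
noncomputable def graphLaplacian {b : ℕ} (ℓ : ℕ) (f : Vertex b → ℝ) (p : Vertex b) : ℝ :=
  (1 / (deg ℓ p : ℝ)) * (∑ e : Edge b ℓ,
    ((if src e = p then f (tgt e) else 0) + (if tgt e = p then f (src e) else 0))) - f p

/-! ### Energy and resistance metric -/

/-- The renormalization constant `r = b / (2b + 1)`. -/
noncomputable def r (b : ℕ) : ℝ := (b : ℝ) / (2 * b + 1)

/-- The graph energy `E_ℓ` of (the restriction to `V_ℓ` of) `f`. -/
noncomputable def graphEnergy {b : ℕ} (ℓ : ℕ) (f : Vertex b → ℝ) : ℝ :=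
  (r b) ^ (-(ℓ : ℤ)) * ∑ e : Edge b ℓ, |f (src e) - f (tgt e)| ^ 2

/-- `f ∈ dom E`: the limit of the graph energies is finite. -/
def FiniteEnergy {b : ℕ} (f : Vertex b → ℝ) : Prop :=
  ∃ L : ℝ, Tendsto (fun ℓ => graphEnergy ℓ f) atTop (𝓝 L)

/-- The energy `E(f) = lim E_ℓ(f)`, for `f ∈ dom E`. -/
noncomputable def energy {b : ℕ} (f : Vertex b → ℝ) : ℝ :=
  limUnder atTop (fun ℓ => graphEnergy ℓ f)

/-- The bilinear form `E(f, g)`, by polarization. -/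
noncomputable def energyForm {b : ℕ} (f g : Vertex b → ℝ) : ℝ :=
  (1 / 4) * (energy (f + g) - energy (f - g))

/-- The resistance `R(p, q)`: the least `R` with `|f(p) - f(q)|² ≤ R E(f)` for all `f ∈ dom E`. -/
noncomputable def resistance {b : ℕ} (p q : Vertex b) : ℝ :=
  sInf {R : ℝ | 0 ≤ R ∧ ∀ f : Vertex b → ℝ, FiniteEnergy f → |f p - f q| ^ 2 ≤ R * energy f}

theorem r_pos (b : ℕ) [NeZero b] : 0 < r b := by
  have : (0 : ℝ) < b := by exact_mod_cast Nat.pos_of_neZero b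
  unfold r
  positivity

theorem r_lt_one (b : ℕ) : r b < 1 := by
  have : (0 : ℝ) ≤ b := Nat.cast_nonneg b
  unfold r
  rw [div_lt_one (by positivity)]
  linarith

theorem graphEnergy_nonneg {b : ℕ} [NeZero b] (ℓ : ℕ) (f : Vertex b → ℝ) : 0 ≤ graphEnergy ℓ f :=
  mul_nonneg (zpow_nonneg (r_pos b).le _) (Finset.sum_nonneg fun _ _ => by positivity)

theorem graphEnergy_zero {b : ℕ} (f : Vertex b → ℝ) : graphEnergy 0 f = (f q1 - f q2) ^ 2 := by
  simp [graphEnergy, src, tgt, cellMap]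

theorem graphEnergy_succ {b : ℕ} [NeZero b] (ℓ : ℕ) (f : Vertex b → ℝ) :
    graphEnergy (ℓ + 1) f = (r b)⁻¹ * ∑ i, graphEnergy ℓ (f ∘ F i) := by
  have hr := (r_pos b).ne'
  unfold graphEnergy
  rw [← Finset.mul_sum, ← mul_assoc]
  congr 1
  · push_cast
    rw [neg_add, zpow_add₀ hr, zpow_neg_one, mul_comm]
  · rw [← Fintype.sum_prod_type', ← (Fin.consEquiv fun _ => Fin (b + 2)).sum_comp]
    rfl

theorem sum_cells {b : ℕ} (g : Fin (b + 2) → ℝ) (c x y : ℝ) (hm : ∀ i, i.val < b → g i = c)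
    (hl : ∀ i, i.val = b → g i = x) (hr : ∀ i, i.val = b + 1 → g i = y) :
    ∑ i, g i = b * c + x + y := by
  have h1 : g (Fin.last (b + 1)) = y := hr _ rfl
  have h2 : g (Fin.last b).castSucc = x := hl _ rfl
  have h3 : ∀ i : Fin b, g i.castSucc.castSucc = c := fun i => hm _ i.2
  simp [Fin.sum_univ_castSucc, h1, h2, h3]

theorem graphEnergy_one {b : ℕ} [NeZero b] (f : Vertex b → ℝ) :
    graphEnergy 1 f = (r b)⁻¹ * (b * (f (p1 []) - f (p2 [])) ^ 2 + (f q1 - f (p1 [])) ^ 2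
      + (f (p2 []) - f q2) ^ 2) := by
  rw [graphEnergy_succ]
  congr 1
  apply sum_cells
  · intro i hi
    simp [graphEnergy_zero, F, hi]
  · intro i hi
    simp [graphEnergy_zero, F, hi]
  · intro i hi
    simp [graphEnergy_zero, F, hi]

theorem graphEnergy_le_succ {b : ℕ} [NeZero b] (ℓ : ℕ) (f : Vertex b → ℝ) :
    graphEnergy ℓ f ≤ graphEnergy (ℓ + 1) f := by
  induction ℓ generalizing f with
  | zero =>
    rw [graphEnergy_one, graphEnergy_zero]
    have hb : (0 : ℝ) < b := by exact_mod_cast Nat.pos_of_neZero b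
    generalize f q1 = a, f q2 = c, f (p1 []) = x, f (p2 []) = y
    rw [r, inv_div, div_mul_eq_mul_div, le_div_iff₀ hb]
    nlinarith [sq_nonneg (b * (x - y) - (a - x)), sq_nonneg (b * (x - y) - (y - c)),
      mul_nonneg hb.le (sq_nonneg ((a - x) - (y - c)))]
  | succ n ih =>
    rw [graphEnergy_succ n, graphEnergy_succ (n + 1)]
    exact mul_le_mul_of_nonneg_left (Finset.sum_le_sum fun i _ => ih _)
      (inv_nonneg.2 (r_pos b).le)

theorem graphEnergy_mono {b : ℕ} [NeZero b] (f : Vertex b → ℝ) :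
    Monotone (fun ℓ => graphEnergy ℓ f) :=
  monotone_nat_of_le_succ fun ℓ => graphEnergy_le_succ ℓ f

theorem FiniteEnergy.tendsto {b : ℕ} {f : Vertex b → ℝ} (hf : FiniteEnergy f) :
    Tendsto (fun ℓ => graphEnergy ℓ f) atTop (𝓝 (energy f)) :=
  tendsto_nhds_limUnder hf

theorem FiniteEnergy.le {b : ℕ} [NeZero b] {f : Vertex b → ℝ} (hf : FiniteEnergy f) (ℓ : ℕ) :
    graphEnergy ℓ f ≤ energy f :=
  (graphEnergy_mono f).ge_of_tendsto hf.tendsto ℓ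

theorem FiniteEnergy.nonneg {b : ℕ} [NeZero b] {f : Vertex b → ℝ} (hf : FiniteEnergy f) :
    0 ≤ energy f :=
  (graphEnergy_nonneg 0 f).trans (hf.le 0)

theorem finiteEnergy_of_le {b : ℕ} [NeZero b] {f : Vertex b → ℝ} {C : ℝ}
    (h : ∀ ℓ, graphEnergy ℓ f ≤ C) : FiniteEnergy f ∧ energy f ≤ C := by
  have hf : FiniteEnergy f :=
    ⟨_, tendsto_atTop_ciSup (graphEnergy_mono f) ⟨C, by rintro _ ⟨ℓ, rfl⟩; exact h ℓ⟩⟩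
  exact ⟨hf, le_of_tendsto' hf.tendsto h⟩

theorem FiniteEnergy.comp_F {b : ℕ} [NeZero b] {f : Vertex b → ℝ} (hf : FiniteEnergy f)
    (i : Fin (b + 2)) : FiniteEnergy (f ∘ F i) ∧ energy (f ∘ F i) ≤ r b * energy f := by
  apply finiteEnergy_of_le
  intro ℓ
  have h := hf.le (ℓ + 1)
  rw [graphEnergy_succ, inv_mul_le_iff₀ (r_pos b)] at h
  exact (Finset.single_le_sum (f := fun i => graphEnergy ℓ (f ∘ F i))
    (fun _ _ => graphEnergy_nonneg _ _) (Finset.mem_univ i)).trans h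

theorem exists_resistance_bound_V1 {b : ℕ} [NeZero b] {f : Vertex b → ℝ} (hf : FiniteEnergy f) :
    |f q2 - f q1| ^ 2 ≤ 4 * energy f ∧ |f (p1 []) - f q1| ^ 2 ≤ 4 * energy f ∧
      |f (p2 []) - f q1| ^ 2 ≤ 4 * energy f := by
  have h0 := hf.le 0
  have h1 := hf.le 1
  have hE := hf.nonneg
  rw [graphEnergy_zero] at h0
  rw [graphEnergy_one, inv_mul_le_iff₀ (r_pos b)] at h1
  have hb : (1 : ℝ) ≤ b := by exact_mod_cast Nat.pos_of_neZero b
  have hr : r b * energy f ≤ energy f := mul_le_of_le_one_left hE (r_lt_one b).le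
  simp only [sq_abs]
  generalize f q1 = a, f q2 = c, f (p1 []) = x, f (p2 []) = y at *
  have h2 : (x - y) ^ 2 ≤ b * (x - y) ^ 2 := le_mul_of_one_le_left (sq_nonneg _) hb
  refine ⟨?_, ?_, ?_⟩
  · nlinarith
  · nlinarith [sq_nonneg (x - y), sq_nonneg (y - c)]
  · nlinarith [sq_nonneg (y - c), sq_nonneg ((a - x) - (x - y))]

theorem exists_resistance_bound {b : ℕ} [NeZero b] (p : Vertex b) :
    ∃ C : ℝ, 0 ≤ C ∧ ∀ f : Vertex b → ℝ, FiniteEnergy f → |f p - f q1| ^ 2 ≤ C * energy f := by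
  have step : ∀ (i : Fin (b + 2)) (p : Vertex b),
      (∃ C : ℝ, 0 ≤ C ∧ ∀ f : Vertex b → ℝ, FiniteEnergy f → |f p - f q1| ^ 2 ≤ C * energy f) →
      ∃ C : ℝ, 0 ≤ C ∧ ∀ f : Vertex b → ℝ, FiniteEnergy f →
        |f (F i p) - f q1| ^ 2 ≤ C * energy f := by
    rintro i p ⟨C, hC, h⟩
    refine ⟨2 * C + 8, by positivity, fun f hf => ?_⟩
    have hE := hf.nonneg
    have h1 := h _ (hf.comp_F i).1
    have h2 : C * energy (f ∘ F i) ≤ C * energy f :=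
      mul_le_mul_of_nonneg_left ((hf.comp_F i).2.trans
        (mul_le_of_le_one_left hE (r_lt_one b).le)) hC
    have h3 : |f (F i q1) - f q1| ^ 2 ≤ 4 * energy f := by
      obtain ⟨-, ha, hb⟩ := exists_resistance_bound_V1 hf
      simp only [F]
      split_ifs
      · exact ha
      · simpa using hE
      · exact hb
    simp only [sq_abs, Function.comp] at h1 h3 ⊢
    nlinarith [sq_nonneg ((f (F i p) - f (F i q1)) - (f (F i q1) - f q1))]
  have key : ∀ w : List (Fin (b + 2)), (∃ C : ℝ, 0 ≤ C ∧ ∀ f : Vertex b → ℝ, FiniteEnergy f →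
      |f (p1 w) - f q1| ^ 2 ≤ C * energy f) ∧ (∃ C : ℝ, 0 ≤ C ∧ ∀ f : Vertex b → ℝ,
      FiniteEnergy f → |f (p2 w) - f q1| ^ 2 ≤ C * energy f) := by
    intro w
    induction w with
    | nil => exact ⟨⟨4, by norm_num, fun f hf => (exists_resistance_bound_V1 hf).2.1⟩,
        ⟨4, by norm_num, fun f hf => (exists_resistance_bound_V1 hf).2.2⟩⟩
    | cons i w ih => exact ⟨step i _ ih.1, step i _ ih.2⟩
  cases p with
  | q1 => exact ⟨0, le_rfl, fun f _ => by simp⟩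
  | q2 => exact ⟨4, by norm_num, fun f hf => (exists_resistance_bound_V1 hf).1⟩
  | p1 w => exact (key w).1
  | p2 w => exact (key w).2

theorem resistance_spec {b : ℕ} [NeZero b] (p q : Vertex b) :
    0 ≤ resistance p q ∧
      ∀ f : Vertex b → ℝ, FiniteEnergy f → |f p - f q| ^ 2 ≤ resistance p q * energy f := by
  have hne : {R : ℝ | 0 ≤ R ∧ ∀ f : Vertex b → ℝ, FiniteEnergy f →
      |f p - f q| ^ 2 ≤ R * energy f}.Nonempty := by
    obtain ⟨C, hC, h⟩ := exists_resistance_bound p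
    obtain ⟨D, hD, h'⟩ := exists_resistance_bound q
    refine ⟨2 * (C + D), by positivity, fun f hf => ?_⟩
    have h1 := h f hf
    have h2 := h' f hf
    simp only [sq_abs] at h1 h2 ⊢
    nlinarith [sq_nonneg ((f p - f q1) + (f q - f q1))]
  have hcl : IsClosed {R : ℝ | 0 ≤ R ∧ ∀ f : Vertex b → ℝ, FiniteEnergy f →
      |f p - f q| ^ 2 ≤ R * energy f} := by
    simp only [Set.ofPred_and, Set.ofPred_forall]
    refine (isClosed_le continuous_const continuous_id).inter
      (isClosed_iInter fun f => isClosed_iInter fun _ => ?_)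
    exact isClosed_le continuous_const (continuous_id.mul continuous_const)
  exact hcl.csInf_mem hne ⟨0, fun R hR => hR.1⟩

theorem resistance_le {b : ℕ} {p q : Vertex b} {R : ℝ} (hR : 0 ≤ R)
    (h : ∀ f : Vertex b → ℝ, FiniteEnergy f → |f p - f q| ^ 2 ≤ R * energy f) :
    resistance p q ≤ R :=
  csInf_le ⟨0, fun _ hR => hR.1⟩ ⟨hR, h⟩

theorem graphEnergy_posPart_add {b : ℕ} [NeZero b] (ℓ : ℕ) (f : Vertex b → ℝ) :
    graphEnergy ℓ (fun x => max (f x) 0) + graphEnergy ℓ (fun x => max (-f x) 0)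
      ≤ graphEnergy ℓ f := by
  unfold graphEnergy
  rw [← mul_add, ← Finset.sum_add_distrib]
  refine mul_le_mul_of_nonneg_left (Finset.sum_le_sum fun e _ => ?_)
    (zpow_nonneg (r_pos b).le _)
  simp only [sq_abs]
  generalize f (src e) = x, f (tgt e) = y
  rcases le_total x 0 with hx | hx <;> rcases le_total y 0 with hy | hy
  · rw [max_eq_right hx, max_eq_right hy, max_eq_left (by linarith), max_eq_left (by linarith)]
    nlinarith
  · rw [max_eq_right hx, max_eq_left hy, max_eq_left (by linarith), max_eq_right (by linarith)]
    nlinarith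
  · rw [max_eq_left hx, max_eq_right hy, max_eq_right (by linarith), max_eq_left (by linarith)]
    nlinarith
  · rw [max_eq_left hx, max_eq_left hy, max_eq_right (by linarith), max_eq_right (by linarith)]
    nlinarith

theorem graphEnergy_affine {b : ℕ} (ℓ : ℕ) (f : Vertex b → ℝ) (s c : ℝ) (hs : s ^ 2 = 1) :
    graphEnergy ℓ (fun x => s * (f x - c)) = graphEnergy ℓ f := by
  unfold graphEnergy
  congr 1
  refine Finset.sum_congr rfl fun e _ => ?_
  simp only [sq_abs]
  linear_combination (f (src e) - f (tgt e)) ^ 2 * hs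

theorem resistance_triangle {b : ℕ} [NeZero b] (p q z : Vertex b) :
    resistance p z ≤ resistance p q + resistance q z := by
  obtain ⟨h1, H1⟩ := resistance_spec p q
  obtain ⟨h2, H2⟩ := resistance_spec q z
  generalize resistance p q = R at *
  generalize resistance q z = S at *
  apply resistance_le (add_nonneg h1 h2)
  have main : ∀ g : Vertex b → ℝ, FiniteEnergy g → g q = 0 → 0 ≤ g p →
      (g p - g z) ^ 2 ≤ (R + S) * energy g := by
    intro g hg hq hp
    have hE := hg.nonneg
    have hP := H1 g hg
    have hZ := H2 g hg
    simp only [sq_abs, hq, sub_zero, zero_sub, neg_sq] at hP hZ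
    rcases le_total 0 (g z) with hz | hz
    · have a1 : 0 ≤ R * energy g := mul_nonneg h1 hE
      have a2 : 0 ≤ S * energy g := mul_nonneg h2 hE
      have a3 : 0 ≤ g p * g z := mul_nonneg hp hz
      rcases le_total (g p) (g z) with h | h
      · nlinarith
      · nlinarith
    · have hpos : ∀ ℓ, graphEnergy ℓ (fun x => max (g x) 0) ≤ energy g := fun ℓ =>
        (le_add_of_nonneg_right (graphEnergy_nonneg _ _)).trans
          ((graphEnergy_posPart_add ℓ g).trans (hg.le ℓ))
      have hneg : ∀ ℓ, graphEnergy ℓ (fun x => max (-g x) 0) ≤ energy g := fun ℓ =>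
        (le_add_of_nonneg_left (graphEnergy_nonneg _ _)).trans
          ((graphEnergy_posPart_add ℓ g).trans (hg.le ℓ))
      have f1 := (finiteEnergy_of_le hpos).1
      have f2 := (finiteEnergy_of_le hneg).1
      have hsum : energy (fun x => max (g x) 0) + energy (fun x => max (-g x) 0) ≤ energy g :=
        le_of_tendsto_of_tendsto' (f1.tendsto.add f2.tendsto) hg.tendsto
          (fun ℓ => graphEnergy_posPart_add ℓ g)
      have e1 := H1 _ f1
      have e2 := H2 _ f2
      simp only [sq_abs, hq, neg_zero, max_self, max_eq_left hp,
        max_eq_left (neg_nonneg.2 hz), sub_zero, zero_sub, neg_neg] at e1 e2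
      have n1 := f1.nonneg
      have n2 := f2.nonneg
      generalize energy (fun x => max (g x) 0) = A at *
      generalize energy (fun x => max (-g x) 0) = B at *
      have k1 : (R + S) * (A + B) ≤ (R + S) * energy g :=
        mul_le_mul_of_nonneg_left hsum (add_nonneg h1 h2)
      refine le_trans ?_ k1
      set x := g p
      set y := -g z with hy
      have hy0 : 0 ≤ y := by linarith
      have hxy : (2 * (x * y)) ^ 2 ≤ (R * B + S * A) ^ 2 := by
        have : x ^ 2 * y ^ 2 ≤ (R * A) * (S * B) :=
          mul_le_mul e1 (by nlinarith) (sq_nonneg _) (mul_nonneg h1 n1)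
        nlinarith [sq_nonneg (R * B - S * A)]
      have hxy' : 2 * (x * y) ≤ R * B + S * A :=
        le_of_sq_le_sq hxy (add_nonneg (mul_nonneg h1 n2) (mul_nonneg h2 n1))
      have : x - g z = x + y := by rw [hy]; ring
      rw [this]
      nlinarith
  intro f hf
  have aff : ∀ s : ℝ, s ^ 2 = 1 → FiniteEnergy (fun x => s * (f x - f q)) ∧
      energy (fun x => s * (f x - f q)) ≤ energy f := fun s hs =>
    finiteEnergy_of_le fun ℓ => (graphEnergy_affine ℓ f s _ hs).le.trans (hf.le ℓ)
  rw [sq_abs]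
  rcases le_total (f q) (f p) with h | h
  · have := main _ (aff 1 (by norm_num)).1 (by ring) (by linarith)
    have k := mul_le_mul_of_nonneg_left (aff 1 (by norm_num)).2 (add_nonneg h1 h2)
    nlinarith
  · have := main _ (aff (-1) (by norm_num)).1 (by ring) (by linarith)
    have k := mul_le_mul_of_nonneg_left (aff (-1) (by norm_num)).2 (add_nonneg h1 h2)
    nlinarith

/-- The resistance metric on `V_*`. -/
noncomputable instance {b : ℕ} [NeZero b] : PseudoMetricSpace (Vertex b) where
  dist := resistance
  dist_self p := le_antisymm (resistance_le le_rfl (by simp)) (resistance_spec p p).1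
  dist_comm p q := by simp only [resistance, abs_sub_comm]
  dist_triangle := resistance_triangle

theorem dist_eq_resistance {b : ℕ} [NeZero b] (p q : Vertex b) : dist p q = resistance p q := rfl

/-! ### The fractal and its self-similar measure -/

end BubbleDiamond

/-- The bubble-diamond fractal `K_b`: the completion of `V_*` in the resistance metric. -/
abbrev BubbleDiamond (b : ℕ) [NeZero b] : Type := UniformSpace.Completion (BubbleDiamond.Vertex b)

namespace BubbleDiamond

open Vertex

instance {b : ℕ} [NeZero b] : Nonempty (BubbleDiamond b) :=
  ⟨((q1 : Vertex b) : BubbleDiamond b)⟩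

noncomputable instance {b : ℕ} [NeZero b] : MeasurableSpace (BubbleDiamond b) := borel _

instance {b : ℕ} [NeZero b] : BorelSpace (BubbleDiamond b) := ⟨rfl⟩

theorem dist_F_le {b : ℕ} [NeZero b] (i : Fin (b + 2)) (p q : Vertex b) :
    dist (F i p) (F i q) ≤ r b * dist p q := by
  obtain ⟨h, H⟩ := resistance_spec p q
  refine resistance_le (mul_nonneg (r_pos b).le h) fun f hf => ?_
  refine (H _ (hf.comp_F i).1).trans ?_
  calc resistance p q * energy (f ∘ F i) ≤ resistance p q * (r b * energy f) :=
        mul_le_mul_of_nonneg_left (hf.comp_F i).2 h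
    _ = r b * resistance p q * energy f := by ring

theorem uniformContinuous_F {b : ℕ} [NeZero b] (i : Fin (b + 2)) :
    UniformContinuous (F i : Vertex b → Vertex b) :=
  (LipschitzWith.of_dist_le_mul (K := (r b).toNNReal) fun p q => by
    rw [Real.coe_toNNReal _ (r_pos b).le]
    exact dist_F_le i p q).uniformContinuous

/-- The continuous extension `F_i : K_b → K_b` of `F_i : V_* → V_*`. -/
noncomputable def FK {b : ℕ} [NeZero b] (i : Fin (b + 2)) : BubbleDiamond b → BubbleDiamond b :=
  UniformSpace.Completion.map (F i)

theorem FK_coe {b : ℕ} [NeZero b] (i : Fin (b + 2)) (p : Vertex b) :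
    FK i (p : BubbleDiamond b) = ((F i p : Vertex b) : BubbleDiamond b) :=
  UniformSpace.Completion.map_coe (uniformContinuous_F i) p

theorem continuous_FK {b : ℕ} [NeZero b] (i : Fin (b + 2)) :
    Continuous (FK i : BubbleDiamond b → BubbleDiamond b) :=
  UniformSpace.Completion.continuous_map

/-- The uniform probability measure on the letters. -/
noncomputable def letterMeasure (b : ℕ) : Measure (Fin (b + 2)) :=
  (PMF.uniformOfFintype (Fin (b + 2))).toMeasure

instance (b : ℕ) : IsProbabilityMeasure (letterMeasure b) :=
  inferInstanceAs (IsProbabilityMeasure (PMF.uniformOfFintype (Fin (b + 2))).toMeasure)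

/-- The point of `K_b` with address `w`: the limit of `F_{w 0} ∘ ⋯ ∘ F_{w (n - 1)} (q1)`. -/
noncomputable def address {b : ℕ} [NeZero b] (w : ℕ → Fin (b + 2)) : BubbleDiamond b :=
  limUnder atTop (fun n : ℕ => ((cellMap n (fun k => w k) q1 : Vertex b) : BubbleDiamond b))

/-- The self-similar probability measure `μ` on `K_b`: the law of the point whose address is a
sequence of independent uniformly distributed letters. -/
noncomputable def mu (b : ℕ) [NeZero b] : Measure (BubbleDiamond b) :=
  (Measure.infinitePi fun _ : ℕ => letterMeasure b).map address

theorem dist_cellMap_le {b : ℕ} [NeZero b] (ℓ : ℕ) (w : Fin ℓ → Fin (b + 2)) (p q : Vertex b) :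
    dist (cellMap ℓ w p) (cellMap ℓ w q) ≤ r b ^ ℓ * dist p q := by
  induction ℓ with
  | zero => simp [cellMap]
  | succ n ih =>
    refine (dist_F_le _ _ _).trans ?_
    rw [pow_succ', mul_assoc]
    exact mul_le_mul_of_nonneg_left (ih _) (r_pos b).le

theorem address_tendsto {b : ℕ} [NeZero b] (w : ℕ → Fin (b + 2)) :
    Tendsto (fun n : ℕ => ((cellMap n (fun k => w k) q1 : Vertex b) : BubbleDiamond b)) atTop
      (𝓝 (address w)) := by
  refine tendsto_nhds_limUnder (cauchySeq_tendsto_of_complete ?_)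
  refine cauchySeq_of_le_geometric (r b) (∑ i, dist (q1 : Vertex b) (F i q1)) (r_lt_one b)
    fun n => ?_
  rw [UniformSpace.Completion.dist_eq, cellMap_snoc, mul_comm]
  refine (dist_cellMap_le _ _ _ _).trans (mul_le_mul_of_nonneg_left ?_ (pow_nonneg (r_pos b).le _))
  exact Finset.single_le_sum (f := fun i => dist (q1 : Vertex b) (F i q1))
    (fun _ _ => dist_nonneg) (Finset.mem_univ _)

theorem measurable_address {b : ℕ} [NeZero b] :
    Measurable (address : (ℕ → Fin (b + 2)) → BubbleDiamond b) := by
  let f : ℕ → (ℕ → Fin (b + 2)) → BubbleDiamond b := fun n w =>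
    ((cellMap n (fun k => w k) q1 : Vertex b) : BubbleDiamond b)
  have hf : ∀ n, Measurable (f n) := by
    intro n
    let g : (Fin n → Fin (b + 2)) → BubbleDiamond b := fun v =>
      ((cellMap n v q1 : Vertex b) : BubbleDiamond b)
    have hg : Measurable g := measurable_of_countable g
    have h' : Measurable fun (w : ℕ → Fin (b + 2)) (k : Fin n) => w k :=
      measurable_pi_lambda _ fun k => measurable_pi_apply (k : ℕ)
    exact hg.comp h'
  have hlim : Tendsto f atTop (𝓝 address) := tendsto_pi_nhds.2 fun w => address_tendsto w
  exact measurable_of_tendsto_metrizable hf hlim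

/-- Put a letter in front of a sequence. -/
def consSeq {b : ℕ} (i : Fin (b + 2)) (w : ℕ → Fin (b + 2)) : ℕ → Fin (b + 2)
  | 0 => i
  | n + 1 => w n

theorem measurable_consSeq {b : ℕ} (i : Fin (b + 2)) : Measurable (consSeq i) :=
  measurable_pi_lambda _ fun n => by
    cases n with
    | zero => exact measurable_const
    | succ n => exact measurable_pi_apply n

theorem address_consSeq {b : ℕ} [NeZero b] (i : Fin (b + 2)) (w : ℕ → Fin (b + 2)) :
    address (consSeq i w) = FK i (address w) := by
  have h1 := (address_tendsto (consSeq i w)).comp (tendsto_add_atTop_nat 1)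
  have h2 := ((continuous_FK i).tendsto _).comp (address_tendsto w)
  refine tendsto_nhds_unique h1 (h2.congr fun n => ?_)
  simp only [Function.comp, FK_coe]
  rfl

theorem letterMeasure_apply {b : ℕ} (s : Set (Fin (b + 2))) :
    letterMeasure b s = ((b : ENNReal) + 2)⁻¹ * ∑ i, s.indicator 1 i := by
  rw [letterMeasure, PMF.toMeasure_apply_fintype, Finset.mul_sum]
  refine Finset.sum_congr rfl fun i _ => ?_
  by_cases h : i ∈ s <;> simp [h]

theorem infinitePi_letterMeasure (b : ℕ) :
    ((b : ENNReal) + 2)⁻¹ • ∑ i, (Measure.infinitePi fun _ : ℕ => letterMeasure b).map (consSeq i)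
      = Measure.infinitePi fun _ : ℕ => letterMeasure b := by
  classical
  refine Measure.eq_infinitePi _ fun s t ht => ?_
  set t' : ℕ → Set (Fin (b + 2)) := fun n => if n ∈ s then t n else Set.univ with ht'
  obtain ⟨N, hN⟩ := s.exists_nat_subset_range
  have hs : s ⊆ Finset.range (N + 1) := hN.trans (Finset.range_mono (Nat.le_succ N))
  have e1 : Set.pi (s : Set ℕ) t = Set.pi (Finset.range (N + 1) : Set ℕ) t' := by
    ext w
    simp only [Set.mem_pi, ht', Finset.mem_coe]
    constructor
    · intro h n _
      split_ifs with hn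
      · exact h n hn
      · trivial
    · intro h n hn
      simpa [hn] using h n (hs hn)
  have e2 : ∏ n ∈ s, letterMeasure b (t n) = ∏ n ∈ Finset.range (N + 1), letterMeasure b (t' n) := by
    rw [← Finset.prod_subset hs (f := fun n => letterMeasure b (t' n))]
    · exact Finset.prod_congr rfl fun n hn => by simp [ht', hn]
    · intro n _ hn
      simp [ht', hn]
  have mt : ∀ n, MeasurableSet (t' n) := fun n => MeasurableSet.of_discrete
  have e3 : ∀ i : Fin (b + 2), (Measure.infinitePi fun _ : ℕ => letterMeasure b).map (consSeq i)
      (Set.pi (Finset.range (N + 1) : Set ℕ) t') =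
      (t' 0).indicator 1 i * ∏ n ∈ Finset.range N, letterMeasure b (t' (n + 1)) := by
    intro i
    rw [Measure.map_apply (measurable_consSeq i)
      (MeasurableSet.pi (Finset.countable_toSet _) fun n _ => mt n)]
    have : consSeq i ⁻¹' Set.pi (Finset.range (N + 1) : Set ℕ) t' =
        if i ∈ t' 0 then Set.pi (Finset.range N : Set ℕ) (fun n => t' (n + 1)) else ∅ := by
      ext w
      split_ifs with hi
      · simp only [Set.mem_preimage, Set.mem_pi, Finset.mem_coe, Finset.mem_range]
        constructor
        · intro h n hn
          exact h (n + 1) (by omega)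
        · intro h n hn
          cases n with
          | zero => exact hi
          | succ n => exact h n (by omega)
      · simp only [Set.mem_preimage, Set.mem_pi, Finset.mem_coe, Finset.mem_range,
          Set.mem_empty_iff_false, iff_false]
        exact fun h => hi (h 0 (by omega))
    rw [this]
    split_ifs with hi
    · rw [Measure.infinitePi_pi _ fun n _ => mt (n + 1)]
      simp [hi]
    · simp [hi]
  rw [e1, e2, Finset.prod_range_succ', Measure.smul_apply, Measure.finsetSum_apply,
    letterMeasure_apply (t' 0), Finset.sum_congr rfl fun i _ => e3 i, ← Finset.sum_mul, smul_eq_mul]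
  ring

instance {b : ℕ} [NeZero b] : IsProbabilityMeasure (mu b) :=
  Measure.isProbabilityMeasure_map measurable_address.aemeasurable

/-- The defining self-similarity of `μ`. -/
theorem mu_selfSimilar {b : ℕ} [NeZero b] {A : Set (BubbleDiamond b)} (hA : MeasurableSet A) :
    mu b A = ((b : ENNReal) + 2)⁻¹ * ∑ i, mu b (FK i ⁻¹' A) := by
  have h : ∀ i : Fin (b + 2), mu b (FK i ⁻¹' A) =
      (Measure.infinitePi fun _ : ℕ => letterMeasure b).map (consSeq i) (address ⁻¹' A) := by
    intro i
    rw [mu, Measure.map_apply measurable_address ((continuous_FK i).measurable hA),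
      Measure.map_apply (measurable_consSeq i) (measurable_address hA)]
    congr 1
    ext w
    simp [address_consSeq]
  simp only [h]
  rw [mu, Measure.map_apply measurable_address hA]
  nth_rw 1 [← infinitePi_letterMeasure b]
  rw [Measure.smul_apply, Measure.finsetSum_apply, smul_eq_mul]

/-! ### The Laplacian -/

/-- Restriction to `V_*` of a function on `K_b`. -/
noncomputable def restr {b : ℕ} [NeZero b] (u : BubbleDiamond b → ℝ) : Vertex b → ℝ :=
  fun p => u (p : BubbleDiamond b)

/-- `u ∈ dom E`, for functions on `K_b`: `u` is the continuous extension of a function of finite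
energy on `V_*`. -/
def MemDomE {b : ℕ} [NeZero b] (u : BubbleDiamond b → ℝ) : Prop :=
  Continuous u ∧ FiniteEnergy (restr u)

/-- `u ∈ dom Δ` with `Δ u = h`. -/
def HasLaplacian {b : ℕ} [NeZero b] (u h : BubbleDiamond b → ℝ) : Prop :=
  MemDomE u ∧ Continuous h ∧ ∀ g : BubbleDiamond b → ℝ, MemDomE g →
    g ((q1 : Vertex b) : BubbleDiamond b) = 0 → g ((q2 : Vertex b) : BubbleDiamond b) = 0 →
      energyForm (restr u) (restr g) = -∫ x, h x * g x ∂(mu b)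

/-- The `m`-th approximant `(2 / (b + 1)) (r / (b + 2))^{-m} deg(p) Δ_m u(p)`, where
`deg(p) Δ_m u(p) = ∑_{p ∼ q} (u(q) - u(p))` is the sum over the edges of `G_m` at `p`. -/
noncomputable def approxLaplacian {b : ℕ} [NeZero b] (m : ℕ) (u : BubbleDiamond b → ℝ)
    (p : Vertex b) : ℝ :=
  2 / ((b : ℝ) + 1) * (r b / ((b : ℝ) + 2)) ^ (-(m : ℤ)) *
    ((deg m p : ℝ) * graphLaplacian m (restr u) p)

end BubbleDiamond

namespace BubbleDiamond

open Vertex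

/-! ### Sums over edges -/

/-! The constant `r` is the one for which harmonic extension to the next level preserves energy:
across `G_1` a harmonic function drops by the fractions `r`, `1 - 2r`, `r` of its total drop, and
`b(1 - 2r) = r`. Hence pairing any `f` with the piecewise harmonic `spline m g` gives the same value
at every level from `m` on, so that `E(f, spline m g) = E_m(f, g)` (`graphForm_harm`,
`graphForm_spline`, `energyForm_spline`). Moreover a harmonic function has mean `(a + c)/2`, so the
trapezoidal rule `edgeMean` integrates splines exactly (`integral_harm`, `integral_spline`).

For (a), test the weak equation with the tent function `ψ`, the spline of `delta p`. The energy side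
is `-r^{-m} deg(p) Δ_m u(p)`, and `∫ ψ = (b+2)^{-m} (b+1)/2`. So `approxLaplacian m u p` is exactly
the `ψ`-weighted mean of `h`. Since `ψ ≥ 0` lives on the cells at `p`, which shrink to `p`,
continuity of `h` finishes the argument.

For (b), summation by parts writes `E_m(u, g)` as minus the edge mean of `g` times the discrete
Laplacian (`graphForm_eq_neg_edgeMean`). Edge means of continuous functions converge to integrals
(`tendsto_edgeMean`), so the limit is the weak equation. That `u` has finite energy comes from the
same formula, applied with `g` equal to `u` minus its harmonic part.

For (c), a test function is transplanted into the `i`-th cell and extended by zero; the energy then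
scales by `1/r` and the integral by `1/(b+2)`. -/

theorem sum_edge_succ {b ℓ : ℕ} (φ : Edge b (ℓ + 1) → ℝ) :
    ∑ e, φ e = ∑ i, ∑ e : Edge b ℓ, φ (Fin.cons i e : Edge b (ℓ + 1)) := by
  rw [← Fintype.sum_prod_type', ← (Fin.consEquiv fun _ => Fin (b + 2)).sum_comp]
  rfl

theorem src_cons {b ℓ : ℕ} (i : Fin (b + 2)) (e : Edge b ℓ) :
    src (Fin.cons i e : Edge b (ℓ + 1)) = F i (src e) := rfl

theorem tgt_cons {b ℓ : ℕ} (i : Fin (b + 2)) (e : Edge b ℓ) :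
    tgt (Fin.cons i e : Edge b (ℓ + 1)) = F i (tgt e) := rfl

/-- Every vertex lies in a cell of level one. -/
theorem exists_F_eq {b : ℕ} (p : Vertex b) : ∃ i q, F i q = p := by
  have h1 : b < b + 2 := by omega
  have h2 : b + 1 < b + 2 := by omega
  rcases p with _ | _ | (_ | ⟨i, w⟩) | (_ | ⟨i, w⟩)
  · exact ⟨⟨b, h1⟩, q1, by simp [F]⟩
  · exact ⟨⟨b + 1, h2⟩, q2, by simp [F]⟩
  · exact ⟨⟨b, h1⟩, q2, by simp [F]⟩
  · exact ⟨i, p1 w, rfl⟩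
  · exact ⟨⟨b + 1, h2⟩, q1, by simp [F]⟩
  · exact ⟨i, p2 w, rfl⟩

/-- Every vertex lies in a cell of level `m`. -/
theorem exists_cellMap_eq {b : ℕ} (m : ℕ) (p : Vertex b) :
    ∃ (e : Edge b m) (q : Vertex b), cellMap m e q = p := by
  induction m generalizing p with
  | zero => exact ⟨Fin.elim0, p, rfl⟩
  | succ m ih =>
    obtain ⟨i, q, rfl⟩ := exists_F_eq p
    obtain ⟨e, q', rfl⟩ := ih q
    exact ⟨Fin.cons i e, q', rfl⟩

/-- Replaces recursion on words by induction along the gluing maps; the base vertices `p1 []` and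
`p2 []` are images of `q2` and `q1` under the two outer maps. -/
theorem vertex_induction {b : ℕ} {P : Vertex b → Prop} (h1 : P q1) (h2 : P q2)
    (h : ∀ i p, P p → P (F i p)) (p : Vertex b) : P p := by
  have hb : b < b + 2 := by omega
  have hb' : b + 1 < b + 2 := by omega
  have k1 : P (p1 []) := by simpa [F] using h ⟨b, hb⟩ q2 h2
  have k2 : P (p2 []) := by simpa [F] using h ⟨b + 1, hb'⟩ q1 h1
  cases p with
  | q1 => exact h1
  | q2 => exact h2
  | p1 w =>
    induction w with
    | nil => exact k1
    | cons i w ih => exact h i _ ih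
  | p2 w =>
    induction w with
    | nil => exact k2
    | cons i w ih => exact h i _ ih

theorem src_mem_V {b m : ℕ} (e : Edge b m) : src e ∈ V b m := by
  induction m with
  | zero => simp [src, cellMap, V]
  | succ m ih => exact Set.mem_iUnion.2 ⟨e 0, _, ih (Fin.tail e), rfl⟩

theorem tgt_mem_V {b m : ℕ} (e : Edge b m) : tgt e ∈ V b m := by
  induction m with
  | zero => simp [tgt, cellMap, V]
  | succ m ih => exact Set.mem_iUnion.2 ⟨e 0, _, ih (Fin.tail e), rfl⟩

/-- The sum of the values of `f` at the endpoints of all edges of `G_ℓ`. -/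
noncomputable def edgeSum {b : ℕ} (ℓ : ℕ) (f : Vertex b → ℝ) : ℝ :=
  ∑ e : Edge b ℓ, (f (src e) + f (tgt e))

theorem edgeSum_zero_level {b : ℕ} (f : Vertex b → ℝ) : edgeSum 0 f = f q1 + f q2 := by
  simp [edgeSum, src, tgt, cellMap]

theorem edgeSum_succ {b : ℕ} (ℓ : ℕ) (f : Vertex b → ℝ) :
    edgeSum (ℓ + 1) f = ∑ i, edgeSum ℓ (f ∘ F i) := by
  simp only [edgeSum, sum_edge_succ, src_cons, tgt_cons, Function.comp]

theorem edgeSum_const {b : ℕ} (ℓ : ℕ) (c : ℝ) :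
    edgeSum ℓ (fun _ : Vertex b => c) = 2 * ((b : ℝ) + 2) ^ ℓ * c := by
  simp [edgeSum]
  ring

theorem edgeSum_mono {b : ℕ} (ℓ : ℕ) {f g : Vertex b → ℝ} (h : ∀ p ∈ V b ℓ, f p ≤ g p) :
    edgeSum ℓ f ≤ edgeSum ℓ g :=
  Finset.sum_le_sum fun e _ => add_le_add (h _ (src_mem_V e)) (h _ (tgt_mem_V e))

/-- The mean over the edges of `G_ℓ` of the mean value of `f` at the two endpoints. -/
noncomputable def edgeMean {b : ℕ} (ℓ : ℕ) (f : Vertex b → ℝ) : ℝ :=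
  (((b : ℝ) + 2) ^ ℓ)⁻¹ * (edgeSum ℓ f / 2)

theorem edgeMean_succ {b : ℕ} (ℓ : ℕ) (f : Vertex b → ℝ) :
    edgeMean (ℓ + 1) f = ((b : ℝ) + 2)⁻¹ * ∑ i, edgeMean ℓ (f ∘ F i) := by
  unfold edgeMean
  rw [edgeSum_succ, ← Finset.mul_sum, ← Finset.sum_div, pow_succ', mul_inv]
  ring

theorem abs_edgeMean_le {b : ℕ} (ℓ : ℕ) {f : Vertex b → ℝ} {C : ℝ}
    (h : ∀ p ∈ V b ℓ, |f p| ≤ C) : |edgeMean ℓ f| ≤ C := by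
  have hb : (0 : ℝ) < ((b : ℝ) + 2) ^ ℓ := by positivity
  have h1 := edgeSum_mono ℓ fun p hp => (abs_le.1 (h p hp)).2
  have h2 := edgeSum_mono ℓ fun p hp => (abs_le.1 (h p hp)).1
  rw [edgeSum_const] at h1 h2
  rw [edgeMean, abs_le, inv_mul_eq_div, div_le_iff₀ hb, le_div_iff₀ hb]
  constructor <;> linarith

theorem edgeMean_sub {b : ℕ} (ℓ : ℕ) (f g : Vertex b → ℝ) :
    edgeMean ℓ (f - g) = edgeMean ℓ f - edgeMean ℓ g := by
  have : edgeSum ℓ (f - g) = edgeSum ℓ f - edgeSum ℓ g := by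
    simp only [edgeSum, ← Finset.sum_sub_distrib, Pi.sub_apply]
    exact Finset.sum_congr rfl fun e _ => by ring
  rw [edgeMean, this, edgeMean, edgeMean]
  ring

/-! ### Degrees -/

open Classical in
/-- The indicator function of a vertex. -/
noncomputable def delta {b : ℕ} (p : Vertex b) : Vertex b → ℝ := fun q => if q = p then 1 else 0

theorem deg_eq_edgeSum {b : ℕ} (ℓ : ℕ) (p : Vertex b) :
    (deg ℓ p : ℝ) = edgeSum ℓ (delta p) := by
  simp [deg, edgeSum, delta]

theorem edgeSum_eq_zero {b : ℕ} (ℓ : ℕ) : edgeSum ℓ (0 : Vertex b → ℝ) = 0 := by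
  simp [edgeSum]

theorem edgeSum_comp_F {b : ℕ} (ℓ : ℕ) {f g : Vertex b → ℝ} {i : Fin (b + 2)}
    (h : ∀ q, f (F i q) = g q) : edgeSum ℓ (f ∘ F i) = edgeSum ℓ g :=
  congrArg (edgeSum ℓ) (funext h)

/-- A boundary point lies in a single level-one cell and is the corresponding boundary point of that
cell, so its degree never grows. -/
theorem edgeSum_delta_q {b : ℕ} (ℓ : ℕ) :
    edgeSum ℓ (delta (q1 : Vertex b)) = 1 ∧ edgeSum ℓ (delta (q2 : Vertex b)) = 1 := by
  induction ℓ with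
  | zero => simp [edgeSum_zero_level, delta]
  | succ ℓ ih =>
    constructor
    · rw [edgeSum_succ, sum_cells _ 0 1 0
        (fun i hi => (edgeSum_comp_F ℓ (g := 0) fun q => by
          cases q <;> simp [delta, F, hi]).trans (edgeSum_eq_zero ℓ))
        (fun i hi => (edgeSum_comp_F ℓ (g := delta q1) fun q => by
          cases q <;> simp [delta, F, hi]).trans ih.1)
        (fun i hi => (edgeSum_comp_F ℓ (g := 0) fun q => by
          cases q <;> simp [delta, F, hi]).trans (edgeSum_eq_zero ℓ))]
      simp
    · rw [edgeSum_succ, sum_cells _ 0 0 1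
        (fun i hi => (edgeSum_comp_F ℓ (g := 0) fun q => by
          cases q <;> simp [delta, F, hi]).trans (edgeSum_eq_zero ℓ))
        (fun i hi => (edgeSum_comp_F ℓ (g := 0) fun q => by
          cases q <;> simp [delta, F, hi]).trans (edgeSum_eq_zero ℓ))
        (fun i hi => (edgeSum_comp_F ℓ (g := delta q2) fun q => by
          cases q <;> simp [delta, F, hi]).trans ih.2)]
      simp

/-- Each of these vertices is a boundary point of the `b` middle cells and of one outer cell, and
each such cell contributes one edge. -/
theorem edgeSum_delta_p_nil {b : ℕ} (ℓ : ℕ) :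
    edgeSum (ℓ + 1) (delta (p1 [] : Vertex b)) = b + 1 ∧
      edgeSum (ℓ + 1) (delta (p2 [] : Vertex b)) = b + 1 := by
  obtain ⟨h1, h2⟩ := edgeSum_delta_q (b := b) ℓ
  constructor
  · rw [edgeSum_succ, sum_cells _ 1 1 0
      (fun i hi => (edgeSum_comp_F ℓ (g := delta q1) fun q => by
        cases q <;> simp [delta, F, hi]).trans h1)
      (fun i hi => (edgeSum_comp_F ℓ (g := delta q2) fun q => by
        cases q <;> simp [delta, F, hi]).trans h2)
      (fun i hi => (edgeSum_comp_F ℓ (g := 0) fun q => by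
        cases q <;> simp [delta, F, hi]).trans (edgeSum_eq_zero ℓ))]
    simp
  · rw [edgeSum_succ, sum_cells _ 1 0 1
      (fun i hi => (edgeSum_comp_F ℓ (g := delta q2) fun q => by
        cases q <;> simp [delta, F, hi]).trans h2)
      (fun i hi => (edgeSum_comp_F ℓ (g := 0) fun q => by
        cases q <;> simp [delta, F, hi]).trans (edgeSum_eq_zero ℓ))
      (fun i hi => (edgeSum_comp_F ℓ (g := delta q1) fun q => by
        cases q <;> simp [delta, F, hi]).trans h1)]
    simp

/-- Such a vertex is interior to the `i`-th cell, so the other copies contribute nothing. -/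
theorem edgeSum_delta_cons {b : ℕ} (ℓ : ℕ) (i : Fin (b + 2)) (w : List (Fin (b + 2))) :
    edgeSum (ℓ + 1) (delta (p1 (i :: w))) = edgeSum ℓ (delta (p1 w)) ∧
      edgeSum (ℓ + 1) (delta (p2 (i :: w))) = edgeSum ℓ (delta (p2 w)) := by
  constructor <;> rw [edgeSum_succ, Finset.sum_eq_single_of_mem i (Finset.mem_univ i)]
  · exact edgeSum_comp_F ℓ fun q => by cases q <;> grind [delta, F]
  · exact fun j _ hj => (edgeSum_comp_F ℓ (g := 0) fun q => by
      rw [Pi.zero_apply]; cases q <;> grind [delta, F]).trans (edgeSum_eq_zero ℓ)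
  · exact edgeSum_comp_F ℓ fun q => by cases q <;> grind [delta, F]
  · exact fun j _ hj => (edgeSum_comp_F ℓ (g := 0) fun q => by
      rw [Pi.zero_apply]; cases q <;> grind [delta, F]).trans (edgeSum_eq_zero ℓ)

/-- Inner vertices have degree `b + 1`. -/
theorem deg_eq {b m : ℕ} {p : Vertex b} (hp : p ∈ V b m) (h0 : p ∉ V b 0) :
    (deg m p : ℝ) = b + 1 := by
  rw [deg_eq_edgeSum]
  induction m generalizing p with
  | zero => exact absurd hp h0
  | succ m ih =>
    obtain ⟨i, q, hq, hqp⟩ := Set.mem_iUnion.1 hp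
    rcases p with _ | _ | (_ | ⟨j, w⟩) | (_ | ⟨j, w⟩)
    · simp [V] at h0
    · simp [V] at h0
    · exact (edgeSum_delta_p_nil m).1
    · have : q = p1 w := by
        cases q <;> simp only [F] at hqp <;> (try split_ifs at hqp) <;> simp_all
      rw [(edgeSum_delta_cons m j w).1]
      exact ih (this ▸ hq) (by simp [V])
    · exact (edgeSum_delta_p_nil m).2
    · have : q = p2 w := by
        cases q <;> simp only [F] at hqp <;> (try split_ifs at hqp) <;> simp_all
      rw [(edgeSum_delta_cons m j w).2]
      exact ih (this ▸ hq) (by simp [V])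

/-! ### The graph energy forms -/

/-- The bilinear form of the graph energy `E_ℓ`. -/
noncomputable def graphForm {b : ℕ} (ℓ : ℕ) (f g : Vertex b → ℝ) : ℝ :=
  (r b) ^ (-(ℓ : ℤ)) * ∑ e : Edge b ℓ, (f (src e) - f (tgt e)) * (g (src e) - g (tgt e))

theorem graphForm_self {b : ℕ} (ℓ : ℕ) (f : Vertex b → ℝ) : graphForm ℓ f f = graphEnergy ℓ f := by
  simp only [graphForm, graphEnergy, sq_abs, pow_two (_ - _)]

theorem graphForm_zero_level {b : ℕ} (f g : Vertex b → ℝ) :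
    graphForm 0 f g = (f q1 - f q2) * (g q1 - g q2) := by
  simp [graphForm, src, tgt, cellMap]

theorem graphForm_succ {b : ℕ} [NeZero b] (ℓ : ℕ) (f g : Vertex b → ℝ) :
    graphForm (ℓ + 1) f g = (r b)⁻¹ * ∑ i, graphForm ℓ (f ∘ F i) (g ∘ F i) := by
  have hr := (r_pos b).ne'
  unfold graphForm
  rw [← Finset.mul_sum, ← mul_assoc, sum_edge_succ]
  congr 1
  push_cast
  rw [neg_add, zpow_add₀ hr, zpow_neg_one, mul_comm]

theorem graphForm_comm {b : ℕ} (ℓ : ℕ) (f g : Vertex b → ℝ) :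
    graphForm ℓ f g = graphForm ℓ g f := by
  simp only [graphForm, mul_comm]

theorem graphForm_sub_left {b : ℕ} (ℓ : ℕ) (f f' g : Vertex b → ℝ) :
    graphForm ℓ (f - f') g = graphForm ℓ f g - graphForm ℓ f' g := by
  simp only [graphForm, ← mul_sub, ← Finset.sum_sub_distrib, Pi.sub_apply]
  congr 1
  exact Finset.sum_congr rfl fun e _ => by ring

theorem graphForm_zero_right {b : ℕ} (ℓ : ℕ) (f : Vertex b → ℝ) : graphForm ℓ f 0 = 0 := by
  simp [graphForm]

theorem graphEnergy_add {b : ℕ} (ℓ : ℕ) (f g : Vertex b → ℝ) :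
    graphEnergy ℓ (f + g) = graphEnergy ℓ f + 2 * graphForm ℓ f g + graphEnergy ℓ g := by
  simp only [graphForm, graphEnergy, sq_abs, mul_left_comm (2 : ℝ), ← mul_add, Finset.mul_sum,
    ← Finset.sum_add_distrib, Pi.add_apply]
  exact Finset.sum_congr rfl fun e _ => by ring

theorem graphEnergy_sub {b : ℕ} (ℓ : ℕ) (f g : Vertex b → ℝ) :
    graphEnergy ℓ (f - g) = graphEnergy ℓ f - 2 * graphForm ℓ f g + graphEnergy ℓ g := by
  simp only [graphForm, graphEnergy, sq_abs, mul_left_comm (2 : ℝ), ← mul_add, ← mul_sub,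
    Finset.mul_sum, ← Finset.sum_add_distrib, ← Finset.sum_sub_distrib, Pi.sub_apply]
  exact Finset.sum_congr rfl fun e _ => by ring

/-- The parallelogram law at each level bounds both energies at once. -/
theorem FiniteEnergy.add_sub {b : ℕ} [NeZero b] {f g : Vertex b → ℝ} (hf : FiniteEnergy f)
    (hg : FiniteEnergy g) : FiniteEnergy (f + g) ∧ FiniteEnergy (f - g) := by
  have h : ∀ ℓ, graphEnergy ℓ (f + g) + graphEnergy ℓ (f - g) ≤ 2 * energy f + 2 * energy g := by
    intro ℓ
    rw [graphEnergy_add, graphEnergy_sub]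
    linarith [hf.le ℓ, hg.le ℓ]
  exact ⟨(finiteEnergy_of_le fun ℓ => (le_add_of_nonneg_right (graphEnergy_nonneg _ _)).trans
    (h ℓ)).1, (finiteEnergy_of_le fun ℓ => (le_add_of_nonneg_left (graphEnergy_nonneg _ _)).trans
    (h ℓ)).1⟩

theorem tendsto_graphForm {b : ℕ} [NeZero b] {f g : Vertex b → ℝ} (hf : FiniteEnergy f)
    (hg : FiniteEnergy g) : Tendsto (fun ℓ => graphForm ℓ f g) atTop (𝓝 (energyForm f g)) := by
  obtain ⟨h1, h2⟩ := hf.add_sub hg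
  refine ((h1.tendsto.sub h2.tendsto).const_mul (1 / 4)).congr fun ℓ => ?_
  rw [graphEnergy_add, graphEnergy_sub]
  ring

/-- The sum `∑_{q ∼ p} (f q - f p)` over the edges of `G_ℓ` at `p`. -/
theorem deg_mul_graphLaplacian {b : ℕ} (ℓ : ℕ) (f : Vertex b → ℝ) (p : Vertex b) :
    (deg ℓ p : ℝ) * graphLaplacian ℓ f p =
      -∑ e : Edge b ℓ, (f (src e) - f (tgt e)) * (delta p (src e) - delta p (tgt e)) := by
  classical
  have key : (deg ℓ p : ℝ) * graphLaplacian ℓ f p = (∑ e : Edge b ℓ,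
      ((if src e = p then f (tgt e) else 0) + (if tgt e = p then f (src e) else 0)))
        - deg ℓ p * f p := by
    -- If no edge meets `p`, the factor `1 / deg` is `1 / 0 = 0` by convention, and both sides
    -- vanish.
    by_cases hd : deg ℓ p = 0
    · have h0 := hd
      simp only [deg, Finset.sum_eq_zero_iff, Finset.mem_univ, forall_const,
        Nat.add_eq_zero_iff, ite_eq_right_iff, one_ne_zero, imp_false] at h0
      rw [hd, Finset.sum_eq_zero fun e _ => by simp [h0 e]]
      simp
    · have : (deg ℓ p : ℝ) ≠ 0 := by exact_mod_cast hd
      rw [graphLaplacian]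
      simp only [mul_sub, one_div, mul_inv_cancel_left₀ this]
  rw [key, deg_eq_edgeSum, edgeSum, Finset.sum_mul, ← Finset.sum_sub_distrib,
    ← Finset.sum_neg_distrib]
  refine Finset.sum_congr rfl fun e _ => ?_
  simp only [delta]
  by_cases h1 : src e = p <;> by_cases h2 : tgt e = p <;> (simp [h1, h2]; try ring)

/-! ### Harmonic functions and splines -/

/-- Values on the words of the harmonic function with boundary values `a`, `c`, where `t a c` is
its value at the empty word. -/
noncomputable def harmWord {b : ℕ} (t : ℝ → ℝ → ℝ) : List (Fin (b + 2)) → ℝ → ℝ → ℝ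
  | [], a, c => t a c
  | i :: w, a, c => harmWord t w
      (if i.val < b then a + r b * (c - a) else if i.val = b then a else c - r b * (c - a))
      (if i.val < b then c - r b * (c - a) else if i.val = b then a + r b * (c - a) else c)

/-- The harmonic function with boundary values `a` at `q1` and `c` at `q2`. -/
noncomputable def harm {b : ℕ} (a c : ℝ) : Vertex b → ℝ
  | q1 => a
  | q2 => c
  | p1 w => harmWord (fun a c => a + r b * (c - a)) w a c
  | p2 w => harmWord (fun a c => c - r b * (c - a)) w a c

theorem harm_F {b : ℕ} (a c : ℝ) (i : Fin (b + 2)) (p : Vertex b) :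
    harm a c (F i p) = harm (harm a c (F i q1)) (harm a c (F i q2)) p := by
  cases p
  · rfl
  · rfl
  all_goals
    simp only [F, harm, harmWord]
    congr 1
    all_goals split_ifs <;> rfl

theorem harm_comp_F {b : ℕ} (a c : ℝ) (i : Fin (b + 2)) :
    harm a c ∘ F i = harm (harm a c (F i q1)) (harm a c (F i q2)) :=
  funext (harm_F a c i)

/-- Reduces every harmonic function to the one with boundary values `0` and `1`, whose integral is
then the only unknown in `integral_harm`. -/
theorem harm_eq {b : ℕ} (a c : ℝ) (p : Vertex b) : harm a c p = a + (c - a) * harm 0 1 p := by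
  induction p using vertex_induction generalizing a c with
  | h1 => simp [harm]
  | h2 => simp [harm]
  | h i p ih =>
    rw [harm_F a c, harm_F 0 1, ih (harm a c _), ih (harm 0 1 _)]
    generalize harm 0 1 p = H
    simp only [F]
    split_ifs <;> simp only [harm, harmWord] <;> ring

/-- The values at the new vertices are convex combinations of `a` and `c`, since `0 < r < 1`. This
makes the tent functions nonnegative weights. -/
theorem harm_nonneg {b : ℕ} [NeZero b] {a c : ℝ} (ha : 0 ≤ a) (hc : 0 ≤ c) (p : Vertex b) :
    0 ≤ harm a c p := by
  have h0 := (r_pos b).le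
  have h1 := (r_lt_one b).le
  have k1 : 0 ≤ a + r b * (c - a) := by nlinarith
  have k2 : 0 ≤ c - r b * (c - a) := by nlinarith
  induction p using vertex_induction generalizing a c with
  | h1 => exact ha
  | h2 => exact hc
  | h i p ih =>
    rw [harm_F]
    have e1 : 0 ≤ harm a c (F i q1) := by
      simp only [F]
      split_ifs <;> assumption
    have e2 : 0 ≤ harm a c (F i q2) := by
      simp only [F]
      split_ifs <;> assumption
    exact ih e1 e2 (by nlinarith) (by nlinarith)

theorem harm_zero {b : ℕ} : (harm 0 0 : Vertex b → ℝ) = 0 := by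
  ext p
  rw [harm_eq]
  simp

/-- Because `b(1 - 2r) = r`, the middle cells together and each outer cell carry the same flow `r(a
- c)`; the increments of `f` then telescope to `f q1 - f q2`, and the factor `r` cancels the
renormalization. -/
theorem graphForm_harm {b : ℕ} [NeZero b] (ℓ : ℕ) (f : Vertex b → ℝ) (a c : ℝ) :
    graphForm ℓ f (harm a c) = (f q1 - f q2) * (a - c) := by
  induction ℓ generalizing f a c with
  | zero => exact graphForm_zero_level _ _
  | succ ℓ ih =>
    simp only [graphForm_succ, harm_comp_F, ih, Function.comp]
    rw [sum_cells _ ((f (p1 []) - f (p2 [])) * ((1 - 2 * r b) * (a - c)))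
      ((f q1 - f (p1 [])) * (r b * (a - c))) ((f (p2 []) - f q2) * (r b * (a - c)))]
    · have hb : (b : ℝ) ≠ 0 := NeZero.ne _
      have h2 : 2 * (b : ℝ) + 1 ≠ 0 := by positivity
      rw [r]
      field_simp
      ring
    all_goals
      intro i hi
      simp only [F, hi, harm, harmWord, lt_irrefl, if_true, if_false, Nat.succ_ne_self,
        not_lt.2 (Nat.le_succ b)]
      ring

theorem finiteEnergy_harm {b : ℕ} [NeZero b] (a c : ℝ) : FiniteEnergy (harm a c : Vertex b → ℝ) :=
  (finiteEnergy_of_le (C := (a - c) * (a - c)) fun ℓ => by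
    rw [← graphForm_self, graphForm_harm]; rfl).1

/-- The function which is given by `f` on `V_1` and by `φ i` in the interior of the `i`-th cell. -/
def glue {b : ℕ} (f : Vertex b → ℝ) (φ : Fin (b + 2) → Vertex b → ℝ) : Vertex b → ℝ
  | p1 (i :: w) => φ i (p1 w)
  | p2 (i :: w) => φ i (p2 w)
  | p => f p

theorem glue_comp_F {b : ℕ} {f : Vertex b → ℝ} {φ : Fin (b + 2) → Vertex b → ℝ}
    {i : Fin (b + 2)} (h1 : φ i q1 = f (F i q1)) (h2 : φ i q2 = f (F i q2)) :
    glue f φ ∘ F i = φ i := by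
  ext p
  cases p
  · simp only [h1, Function.comp, F]
    split_ifs <;> rfl
  · simp only [h2, Function.comp, F]
    split_ifs <;> rfl
  · rfl
  · rfl

/-- The function which agrees with `f` on `V_m` and is harmonic in each cell of level `m`. -/
noncomputable def spline {b : ℕ} : ℕ → (Vertex b → ℝ) → Vertex b → ℝ
  | 0, f => harm (f q1) (f q2)
  | m + 1, f => glue f fun i => spline m (f ∘ F i)

theorem spline_boundary {b : ℕ} (m : ℕ) (f : Vertex b → ℝ) :
    spline m f q1 = f q1 ∧ spline m f q2 = f q2 := by
  cases m <;> exact ⟨rfl, rfl⟩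

theorem spline_succ_comp_F {b : ℕ} (m : ℕ) (f : Vertex b → ℝ) (i : Fin (b + 2)) :
    spline (m + 1) f ∘ F i = spline m (f ∘ F i) :=
  glue_comp_F (φ := fun i => spline m (f ∘ F i)) (spline_boundary m _).1 (spline_boundary m _).2

theorem spline_cellMap {b : ℕ} (m : ℕ) (f : Vertex b → ℝ) (e : Edge b m) (p : Vertex b) :
    spline m f (cellMap m e p) = harm (f (src e)) (f (tgt e)) p := by
  induction m generalizing f with
  | zero => rfl
  | succ m ih =>
    exact (congrFun (spline_succ_comp_F m f (e 0)) _).trans (ih (f ∘ F (e 0)) (Fin.tail e))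

/-- `graphForm_harm` applied in each cell of level `m`: refining beyond level `m` does not change
the pairing with a spline, whatever `f` is. -/
theorem graphForm_spline {b : ℕ} [NeZero b] (m ℓ : ℕ) (f g : Vertex b → ℝ) :
    graphForm (ℓ + m) f (spline m g) = graphForm m f g := by
  induction m generalizing f g with
  | zero => exact (graphForm_harm _ _ _ _).trans (graphForm_zero_level _ _).symm
  | succ m ih => simp only [← add_assoc, graphForm_succ, spline_succ_comp_F, ih]

theorem finiteEnergy_spline {b : ℕ} [NeZero b] (m : ℕ) (g : Vertex b → ℝ) :
    FiniteEnergy (spline m g) :=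
  (finiteEnergy_of_le (C := graphForm m (spline m g) g) fun ℓ =>
    (graphEnergy_mono _ (Nat.le_add_right ℓ m)).trans
      ((graphForm_self _ _).symm.trans (graphForm_spline m ℓ _ g)).le).1

/-- The bridge from the limiting form to the finite graphs: the sequence defining the left side is
eventually constant. -/
theorem energyForm_spline {b : ℕ} [NeZero b] (m : ℕ) {f : Vertex b → ℝ} (hf : FiniteEnergy f)
    (g : Vertex b → ℝ) : energyForm f (spline m g) = graphForm m f g :=
  tendsto_nhds_unique
    ((tendsto_graphForm hf (finiteEnergy_spline m g)).comp (tendsto_add_atTop_nat m))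
    (tendsto_const_nhds.congr fun ℓ => (graphForm_spline m ℓ f g).symm)

/-! ### Continuous extensions and compactness -/

theorem FiniteEnergy.uniformContinuous {b : ℕ} [NeZero b] {f : Vertex b → ℝ}
    (hf : FiniteEnergy f) : UniformContinuous f := by
  have hE := hf.nonneg
  refine Metric.uniformContinuous_iff.2 fun ε hε =>
    -- Resistance bounds squared differences, hence `ε ^ 2`; the `+ 1` covers zero energy.
    ⟨ε ^ 2 / (energy f + 1), by positivity, fun {p q} h => ?_⟩
  rw [lt_div_iff₀ (by positivity)] at h
  have h1 := (resistance_spec p q).2 f hf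
  rw [← dist_eq_resistance] at h1
  rw [Real.dist_eq]
  refine lt_of_pow_lt_pow_left₀ 2 hε.le ?_
  nlinarith [dist_nonneg (x := p) (y := q)]

/-- Functions of finite energy extend to elements of `dom E`. -/
theorem FiniteEnergy.exists_extension {b : ℕ} [NeZero b] {f : Vertex b → ℝ}
    (hf : FiniteEnergy f) : ∃ u : BubbleDiamond b → ℝ, MemDomE u ∧ restr u = f := by
  have h : restr (UniformSpace.Completion.extension f) = f :=
    funext fun p => UniformSpace.Completion.extension_coe hf.uniformContinuous p
  exact ⟨_, ⟨UniformSpace.Completion.continuous_extension, h.symm ▸ hf⟩, h⟩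

/-- The distance `d` to `q1` satisfies `d(F_i p) ≤ r d(p) + C`, so the fixed point `C / (1 - r)` of
this recursion bounds it along `vertex_induction`. -/
theorem exists_dist_le (b : ℕ) [NeZero b] :
    ∃ D : ℝ, 0 ≤ D ∧ ∀ p q : Vertex b, dist p q ≤ D := by
  set C := dist (q1 : Vertex b) q2 + ∑ i, dist (F i q1) (q1 : Vertex b) with hC
  have hr : 0 < 1 - r b := sub_pos.2 (r_lt_one b)
  have hsum : 0 ≤ ∑ i, dist (F i q1) (q1 : Vertex b) := Finset.sum_nonneg fun _ _ => dist_nonneg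
  have hC0 : 0 ≤ C := add_nonneg dist_nonneg hsum
  have hC1 : C ≤ C / (1 - r b) := by
    rw [le_div_iff₀ hr]
    nlinarith [r_pos b]
  have key : ∀ p : Vertex b, dist p q1 ≤ C / (1 - r b) := by
    intro p
    induction p using vertex_induction with
    | h1 =>
      rw [dist_self]
      positivity
    | h2 =>
      rw [dist_comm]
      linarith
    | h i p ih =>
      have h1 : dist (F i q1) (q1 : Vertex b) ≤ C :=
        (Finset.single_le_sum (f := fun i => dist (F i q1) (q1 : Vertex b))
          (fun _ _ => dist_nonneg) (Finset.mem_univ i)).trans (le_add_of_nonneg_left dist_nonneg)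
      have h2 := mul_le_mul_of_nonneg_left ih (r_pos b).le
      have h3 : r b * (C / (1 - r b)) + C = C / (1 - r b) := by
        field_simp
        ring
      linarith [dist_triangle (F i p) (F i q1) q1, dist_F_le i p q1]
  refine ⟨2 * (C / (1 - r b)), by positivity, fun p q => ?_⟩
  linarith [dist_triangle_right p q q1, key p, key q]

/-- Cells of a high level are small. -/
theorem exists_cell_dist_lt (b : ℕ) [NeZero b] {ε : ℝ} (hε : 0 < ε) :
    ∃ M : ℕ, ∀ m, M ≤ m → ∀ (e : Edge b m) (p q : Vertex b),
      dist (cellMap m e p) (cellMap m e q) < ε := by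
  obtain ⟨D, hD, h⟩ := exists_dist_le b
  have ht : Tendsto (fun m : ℕ => r b ^ m * D) atTop (𝓝 0) := by
    simpa using (tendsto_pow_atTop_nhds_zero_of_lt_one (r_pos b).le (r_lt_one b)).mul_const D
  obtain ⟨M, hM⟩ := eventually_atTop.1 (ht.eventually_lt_const hε)
  exact ⟨M, fun m hm e p q => ((dist_cellMap_le m e p q).trans
    (mul_le_mul_of_nonneg_left (h p q) (pow_nonneg (r_pos b).le m))).trans_lt (hM m hm)⟩

/-- One endpoint from each of the finitely many cells of a high level gives a finite net of `V_*`,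
so its completion is compact. -/
instance {b : ℕ} [NeZero b] : CompactSpace (BubbleDiamond b) := by
  have h : TotallyBounded (Set.univ : Set (Vertex b)) := by
    refine Metric.totallyBounded_iff.2 fun ε hε => ?_
    obtain ⟨M, hM⟩ := exists_cell_dist_lt b hε
    refine ⟨Set.range (src : Edge b M → Vertex b), Set.finite_range _, fun p _ => ?_⟩
    obtain ⟨e, q, rfl⟩ := exists_cellMap_eq M p
    exact Set.mem_biUnion ⟨e, rfl⟩ (hM M le_rfl e q q1)
  have h' := (h.image (UniformSpace.Completion.uniformContinuous_coe (Vertex b))).closure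
  rw [Set.image_univ, UniformSpace.Completion.denseRange_coe.closure_range] at h'
  exact ⟨h'.isCompact_of_isClosed isClosed_univ⟩

theorem exists_abs_le {b : ℕ} [NeZero b] {φ : BubbleDiamond b → ℝ} (hφ : Continuous φ) :
    ∃ C : ℝ, 0 ≤ C ∧ ∀ x, |φ x| ≤ C := by
  obtain ⟨C, hC⟩ := isCompact_univ.exists_bound_of_continuousOn hφ.continuousOn
  exact ⟨C, (norm_nonneg _).trans (hC (q1 : Vertex b) trivial), fun x => hC x trivial⟩

/-! ### Integrals -/

theorem integrable_mu {b : ℕ} [NeZero b] {φ : BubbleDiamond b → ℝ} (hφ : Continuous φ) :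
    Integrable φ (mu b) :=
  hφ.integrable_of_hasCompactSupport (HasCompactSupport.of_compactSpace φ)

theorem integral_mu {b : ℕ} [NeZero b] {φ : BubbleDiamond b → ℝ} (hφ : Continuous φ) :
    ∫ x, φ x ∂(mu b) = ((b : ℝ) + 2)⁻¹ * ∑ i, ∫ x, φ (FK i x) ∂(mu b) := by
  have h : mu b = ((b : ENNReal) + 2)⁻¹ • ∑ i, (mu b).map (FK i) := by
    ext A hA
    rw [mu_selfSimilar hA, Measure.smul_apply, Measure.finsetSum_apply, smul_eq_mul]
    congr 1
    exact Finset.sum_congr rfl fun i _ => (Measure.map_apply (continuous_FK i).measurable hA).symm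
  have hint : ∀ i : Fin (b + 2), Integrable φ ((mu b).map (FK i)) := fun i =>
    (integrable_map_measure hφ.aestronglyMeasurable (continuous_FK i).aemeasurable).2
      (integrable_mu (hφ.comp (continuous_FK i)))
  conv_lhs => rw [h]
  rw [integral_smul_measure, integral_finsetSum_measure fun i _ => hint i]
  congr 1
  · rw [ENNReal.toReal_inv]
    norm_cast
  · exact Finset.sum_congr rfl fun i _ =>
      integral_map (continuous_FK i).aemeasurable hφ.aestronglyMeasurable

theorem restr_comp_FK {b : ℕ} [NeZero b] (u : BubbleDiamond b → ℝ) (i : Fin (b + 2)) :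
    restr (fun x => u (FK i x)) = restr u ∘ F i := by
  ext p
  simp [restr, FK_coe]

/-- The integral and the edge mean obey the same self-similar recursion, so the error is an average
of single-cell errors, each at most the oscillation of `φ` on the cell. -/
theorem abs_integral_sub_edgeMean_le {b : ℕ} [NeZero b] (m : ℕ) {φ : BubbleDiamond b → ℝ}
    (hφ : Continuous φ) {ε : ℝ} (h : ∀ (e : Edge b m) (p q : Vertex b),
      |restr φ (cellMap m e p) - restr φ (cellMap m e q)| ≤ ε) :
    |∫ x, φ x ∂(mu b) - edgeMean m (restr φ)| ≤ ε := by
  induction m generalizing φ with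
  | zero =>
    have h1 : ∀ q : Vertex b, |∫ x, φ x ∂(mu b) - restr φ q| ≤ ε := by
      intro q
      have hx : ∀ x, ‖φ x - restr φ q‖ ≤ ε := fun x =>
        UniformSpace.Completion.induction_on x
          (isClosed_le (hφ.sub continuous_const).norm continuous_const)
          fun p => h Fin.elim0 p q
      have := norm_integral_le_of_norm_le_const (μ := mu b) (Eventually.of_forall hx)
      rw [integral_sub (integrable_mu hφ) (integrable_const _)] at this
      simpa using this
    have e1 := abs_le.1 (h1 q1)
    have e2 := abs_le.1 (h1 q2)
    rw [edgeMean, edgeSum_zero_level, abs_le]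
    constructor <;> simp only [pow_zero, inv_one, one_mul] <;> linarith
  | succ m ih =>
    have h1 : ∀ i, |∫ x, φ (FK i x) ∂(mu b) - edgeMean m (restr φ ∘ F i)| ≤ ε := by
      intro i
      rw [← restr_comp_FK]
      refine ih (hφ.comp (continuous_FK i)) fun e p q => ?_
      rw [restr_comp_FK]
      exact h (Fin.cons i e) p q
    rw [integral_mu hφ, edgeMean_succ, ← mul_sub, ← Finset.sum_sub_distrib, abs_mul,
      abs_of_pos (by positivity), inv_mul_le_iff₀ (by positivity)]
    refine (Finset.abs_sum_le_sum_abs _ _).trans ((Finset.sum_le_sum fun i _ => h1 i).trans ?_)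
    simp

theorem tendsto_edgeMean {b : ℕ} [NeZero b] {φ : BubbleDiamond b → ℝ} (hφ : Continuous φ) :
    Tendsto (fun m => edgeMean m (restr φ)) atTop (𝓝 (∫ x, φ x ∂(mu b))) := by
  refine Metric.tendsto_atTop.2 fun ε hε => ?_
  have hu := CompactSpace.uniformContinuous_of_continuous hφ
  obtain ⟨δ, hδ, h⟩ := Metric.uniformContinuous_iff.1 hu (ε / 2) (half_pos hε)
  obtain ⟨M, hM⟩ := exists_cell_dist_lt b hδ
  refine ⟨M, fun m hm => ?_⟩
  rw [dist_comm, Real.dist_eq]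
  refine (abs_integral_sub_edgeMean_le m hφ fun e p q => ?_).trans_lt (half_lt_self hε)
  exact (h (by rw [UniformSpace.Completion.dist_eq]; exact hM m hm e p q)).le

/-- Self-similarity of `mu` gives a linear equation for the integral `I` of the harmonic function
with boundary values `0` and `1`, which reduces to `(b + 2 - 3r)(2I - 1) = 0`. -/
theorem integral_harm {b : ℕ} [NeZero b] {φ : BubbleDiamond b → ℝ} (hφ : Continuous φ)
    {a c : ℝ} (h : restr φ = harm a c) : ∫ x, φ x ∂(mu b) = (a + c) / 2 := by
  obtain ⟨η, ⟨hη, -⟩, hη'⟩ := (finiteEnergy_harm (b := b) 0 1).exists_extension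
  have lin : ∀ (a c : ℝ) (φ : BubbleDiamond b → ℝ), Continuous φ → restr φ = harm a c →
      ∫ x, φ x ∂(mu b) = a + (c - a) * ∫ x, η x ∂(mu b) := by
    intro a c φ hφ h
    have : ∀ x, φ x = a + (c - a) * η x := fun x =>
      UniformSpace.Completion.induction_on x
        (isClosed_eq hφ (continuous_const.add (continuous_const.mul hη))) fun p => by
          change restr φ p = a + (c - a) * restr η p
          rw [h, hη', harm_eq]
    simp only [this]
    rw [integral_add (integrable_const _) ((integrable_mu hη).const_mul _), integral_const_mul]
    simp
  have hI := integral_mu hη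
  rw [Finset.sum_congr rfl fun i _ => lin (harm 0 1 (F i q1)) (harm 0 1 (F i q2))
    (fun x => η (FK i x))
    (hη.comp (continuous_FK i)) (by rw [restr_comp_FK, hη', harm_comp_F])] at hI
  rw [lin a c φ hφ h]
  generalize ∫ x, η x ∂(mu b) = I at *
  rw [sum_cells _ (r b + (1 - 2 * r b) * I) (r b * I) (1 - r b + r b * I)] at hI
  · have hb : (0 : ℝ) < b := by exact_mod_cast Nat.pos_of_neZero b
    rw [eq_inv_mul_iff_mul_eq₀ (by positivity)] at hI
    have hr : r b * (2 * b + 1) = b := div_mul_cancel₀ _ (by positivity)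
    have : (b + 2 - 3 * r b) * (2 * I - 1) = 0 := by linear_combination 2 * hI + (1 - 2 * I) * hr
    rcases mul_eq_zero.1 this with h | h
    -- The first factor is positive, as `b ≥ 1` and `r < 1`.
    · nlinarith [r_lt_one b, Nat.one_le_cast (α := ℝ).2 (Nat.pos_of_neZero b)]
    · linear_combination (c - a) / 2 * h
  all_goals
    intro i hi
    simp only [F, hi, harm, harmWord, lt_irrefl, if_true, if_false, Nat.succ_ne_self,
      not_lt.2 (Nat.le_succ b)]
    ring

theorem integral_spline {b : ℕ} [NeZero b] (m : ℕ) {φ : BubbleDiamond b → ℝ} (hφ : Continuous φ)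
    {g : Vertex b → ℝ} (h : restr φ = spline m g) : ∫ x, φ x ∂(mu b) = edgeMean m g := by
  induction m generalizing φ g with
  | zero =>
    rw [integral_harm hφ h]
    simp [edgeMean, edgeSum_zero_level]
  | succ m ih =>
    rw [integral_mu hφ, edgeMean_succ]
    congr 1
    exact Finset.sum_congr rfl fun i _ => ih (φ := fun x => φ (FK i x))
      (hφ.comp (continuous_FK i)) (by rw [restr_comp_FK, h, spline_succ_comp_F])

/-! ### The discrete Gauss–Green formula -/

theorem V_mono (b : ℕ) : Monotone (V b) := by
  refine monotone_nat_of_le_succ fun m => ?_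
  induction m with
  | zero =>
    rintro p (rfl | rfl)
    · exact Set.mem_iUnion.2 ⟨⟨b, by omega⟩, q1, by simp [V], by simp [F]⟩
    · exact Set.mem_iUnion.2 ⟨⟨b + 1, by omega⟩, q2, by simp [V], by simp [F]⟩
  | succ m ih => exact Set.iUnion_mono fun i => Set.image_mono ih

theorem exists_finset_V (b m : ℕ) : ∃ S : Finset (Vertex b), ∀ p, p ∈ S ↔ p ∈ V b m := by
  have h : (V b m).Finite := by
    induction m with
    | zero => simp [V]
    | succ m ih => exact Set.finite_iUnion fun i => ih.image _
  exact ⟨h.toFinset, fun p => h.mem_toFinset⟩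

theorem sum_mul_delta {b : ℕ} {S : Finset (Vertex b)} (φ : Vertex b → ℝ) {q : Vertex b}
    (hq : q ∈ S) : ∑ p ∈ S, φ p * delta p q = φ q := by
  classical
  simp only [delta, mul_ite, mul_one, mul_zero]
  exact (Finset.sum_ite_eq S q φ).trans (if_pos hq)

theorem graphForm_eq_sum {b m : ℕ} {S : Finset (Vertex b)} (hS : ∀ p, p ∈ S ↔ p ∈ V b m)
    (f g : Vertex b → ℝ) : graphForm m f g = ∑ p ∈ S, g p * graphForm m f (delta p) := by
  have key : ∀ e : Edge b m, (f (src e) - f (tgt e)) * (g (src e) - g (tgt e)) =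
      ∑ p ∈ S, g p * ((f (src e) - f (tgt e)) * (delta p (src e) - delta p (tgt e))) := by
    intro e
    rw [← sum_mul_delta g ((hS _).2 (src_mem_V e)), ← sum_mul_delta g ((hS _).2 (tgt_mem_V e)),
      ← Finset.sum_sub_distrib, Finset.mul_sum]
    exact Finset.sum_congr rfl fun p _ => by ring
  rw [graphForm, Finset.sum_congr rfl fun e _ => key e, Finset.sum_comm, Finset.mul_sum]
  refine Finset.sum_congr rfl fun p _ => ?_
  rw [← Finset.mul_sum, graphForm]
  ring

theorem edgeMean_eq_sum {b m : ℕ} {S : Finset (Vertex b)} (hS : ∀ p, p ∈ S ↔ p ∈ V b m)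
    (f : Vertex b → ℝ) : edgeMean m f = ∑ p ∈ S, f p * edgeMean m (delta p) := by
  have key : ∀ e : Edge b m, f (src e) + f (tgt e) =
      ∑ p ∈ S, f p * (delta p (src e) + delta p (tgt e)) := by
    intro e
    rw [← sum_mul_delta f ((hS _).2 (src_mem_V e)), ← sum_mul_delta f ((hS _).2 (tgt_mem_V e)),
      ← Finset.sum_add_distrib]
    exact Finset.sum_congr rfl fun p _ => by ring
  rw [edgeMean, edgeSum, Finset.sum_congr rfl fun e _ => key e, Finset.sum_comm, Finset.sum_div,
    Finset.mul_sum]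
  refine Finset.sum_congr rfl fun p _ => ?_
  rw [← Finset.mul_sum, edgeMean, edgeSum]
  ring

theorem edgeMean_delta {b m : ℕ} {p : Vertex b} (hp : p ∈ V b m) (h0 : p ∉ V b 0) :
    edgeMean m (delta p) = (((b : ℝ) + 2) ^ m)⁻¹ * (((b : ℝ) + 1) / 2) := by
  rw [edgeMean, ← deg_eq_edgeSum, deg_eq hp h0]

/-- Explains the constant `2 / (b + 1)`: it and `(b + 2) ^ m` undo the mass `(b + 1) / 2 * (b + 2) ^
(-m)` of the tent function, leaving the energy factor `r ^ (-m)`. -/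
theorem graphForm_delta {b : ℕ} [NeZero b] {m : ℕ} (u : BubbleDiamond b → ℝ) {p : Vertex b}
    (hp : p ∈ V b m) (h0 : p ∉ V b 0) :
    graphForm m (restr u) (delta p) = -(approxLaplacian m u p * edgeMean m (delta p)) := by
  have hr := (r_pos b).ne'
  rw [edgeMean_delta hp h0, approxLaplacian, deg_mul_graphLaplacian, graphForm, zpow_neg,
    zpow_neg, zpow_natCast, zpow_natCast, div_pow]
  field_simp

/-- The discrete Gauss–Green formula. -/
theorem graphForm_eq_neg_edgeMean {b : ℕ} [NeZero b] (m : ℕ) (u : BubbleDiamond b → ℝ)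
    {g : Vertex b → ℝ} (h1 : g q1 = 0) (h2 : g q2 = 0) :
    graphForm m (restr u) g = -edgeMean m (fun p => g p * approxLaplacian m u p) := by
  obtain ⟨S, hS⟩ := exists_finset_V b m
  rw [graphForm_eq_sum hS, edgeMean_eq_sum hS, ← Finset.sum_neg_distrib]
  refine Finset.sum_congr rfl fun p hp => ?_
  by_cases h0 : p ∈ V b 0
  -- At the boundary the discrete Laplacian is uncontrolled, but `g` vanishes there.
  · rcases h0 with rfl | rfl <;> simp [h1, h2]
  · rw [graphForm_delta u ((hS p).1 hp) h0]
    ring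

/-! ### The pointwise formula -/

/-- The weak equation tested with a tent function; no error term appears, since both the energy and
the integral of a spline are computed exactly at level `m`. -/
theorem HasLaplacian.approxLaplacian_mul {b : ℕ} [NeZero b] {u h : BubbleDiamond b → ℝ}
    (hu : HasLaplacian u h) {m : ℕ} {p : Vertex b} (hp : p ∈ V b m) (h0 : p ∉ V b 0)
    {ψ : BubbleDiamond b → ℝ} (hψ : MemDomE ψ) (hψ' : restr ψ = spline m (delta p)) :
    approxLaplacian m u p * ∫ x, ψ x ∂(mu b) = ∫ x, h x * ψ x ∂(mu b) := by
  have hp1 : p ≠ q1 := fun h => h0 (Or.inl h)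
  have hp2 : p ≠ q2 := fun h => h0 (Or.inr h)
  have e := hu.2.2 ψ hψ
    (by
      change restr ψ q1 = 0
      rw [hψ', (spline_boundary m _).1]
      simp [delta, hp1.symm])
    (by
      change restr ψ q2 = 0
      rw [hψ', (spline_boundary m _).2]
      simp [delta, hp2.symm])
  rw [hψ', energyForm_spline m hu.1.2, graphForm_delta u hp h0, neg_inj] at e
  rw [integral_spline m hψ.1 hψ', e]

/-- The spline of `delta p` is nonnegative and vanishes off the cells which contain `p`. -/
theorem abs_mul_spline_delta_le {b : ℕ} [NeZero b] {m : ℕ} {p : Vertex b} {η : Vertex b → ℝ}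
    {ε : ℝ} (h : ∀ (e : Edge b m) (q : Vertex b), src e = p ∨ tgt e = p →
      |η (cellMap m e q)| ≤ ε) (q : Vertex b) :
    |η q * spline m (delta p) q| ≤ ε * spline m (delta p) q := by
  obtain ⟨e, q, rfl⟩ := exists_cellMap_eq m q
  rw [spline_cellMap]
  have hδ : ∀ z, 0 ≤ delta p z := fun z => by
    unfold delta
    split_ifs <;> norm_num
  by_cases he : src e = p ∨ tgt e = p
  · have hn := harm_nonneg (hδ (src e)) (hδ (tgt e)) q
    rw [abs_mul, abs_of_nonneg hn]
    exact mul_le_mul_of_nonneg_right (h e q he) hn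
  · rw [not_or] at he
    simp [delta, he.1, he.2, harm_zero]

theorem HasLaplacian.tendsto_approxLaplacian {b : ℕ} [NeZero b] {u h : BubbleDiamond b → ℝ}
    (hu : HasLaplacian u h) {p : Vertex b} (h0 : p ∉ V b 0) :
    Tendsto (fun m => approxLaplacian m u p) atTop (𝓝 (h p)) := by
  have hh := hu.2.1
  refine Metric.tendsto_atTop.2 fun ε hε => ?_
  obtain ⟨δ, hδ, hc⟩ := Metric.continuous_iff.1 hh p (ε / 2) (half_pos hε)
  obtain ⟨M, hM⟩ := exists_cell_dist_lt b hδ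
  obtain ⟨N, hN⟩ := Set.mem_iUnion.1 ((iUnion_V b).symm ▸ Set.mem_univ p)
  refine ⟨max M N, fun m hm => ?_⟩
  have hp : p ∈ V b m := V_mono b ((le_max_right M N).trans hm) hN
  obtain ⟨ψ, hψ, hψ'⟩ := (finiteEnergy_spline m (delta p)).exists_extension
  have key := hu.approxLaplacian_mul hp h0 hψ hψ'
  have hpos : 0 < ∫ x, ψ x ∂(mu b) := by
    rw [integral_spline m hψ.1 hψ', edgeMean_delta hp h0]
    positivity
  -- On the support of `ψ` the function `h` is within `ε / 2` of `h p`; elsewhere both sides vanish.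
  -- The bound passes from `V_*` to its completion by density.
  have hle : ∀ x, ‖(h x - h p) * ψ x‖ ≤ ε / 2 * ψ x := fun x =>
    UniformSpace.Completion.induction_on x
      (isClosed_le ((hh.sub continuous_const).mul hψ.1).norm (continuous_const.mul hψ.1)) fun q => by
        have := abs_mul_spline_delta_le (m := m) (p := p) (η := fun q => h q - h p) (ε := ε / 2)
          (fun e q he => (hc _ (by
            rw [UniformSpace.Completion.dist_eq]
            rcases he with rfl | rfl
            · exact hM m ((le_max_left M N).trans hm) e q q1
            · exact hM m ((le_max_left M N).trans hm) e q q2)).le) q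
        rwa [← hψ'] at this
  have hint := norm_integral_le_of_norm_le ((integrable_mu hψ.1).const_mul (ε / 2))
    (Eventually.of_forall hle)
  simp only [sub_mul] at hint
  rw [integral_sub (integrable_mu (φ := fun x => h x * ψ x) (hh.mul hψ.1))
      ((integrable_mu hψ.1).const_mul _),
    integral_const_mul, integral_const_mul, ← key, ← sub_mul, norm_mul,
    Real.norm_of_nonneg hpos.le] at hint
  rw [dist_eq_norm]
  exact (le_of_mul_le_mul_right hint hpos).trans_lt (half_lt_self hε)

/-! ### Functions with uniformly convergent discrete Laplacians -/

/-- Let `f` be `u` minus the harmonic function with the same boundary values. As `f` vanishes on the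
boundary, it is orthogonal to harmonic functions, so `E_m(f) = E_m(u, f)`. The Gauss–Green formula
bounds this by the sup norm of `f` times that of the discrete Laplacian. -/
theorem MemDomE.of_uniform {b : ℕ} [NeZero b] {u h : BubbleDiamond b → ℝ} (hu : Continuous u)
    (hh : Continuous h) {M : ℕ} (H : ∀ m, M ≤ m → ∀ p ∈ V b m \ V b 0,
      |approxLaplacian m u p - h (p : BubbleDiamond b)| < 1) : MemDomE u := by
  refine ⟨hu, ?_⟩
  have hH := finiteEnergy_harm (b := b) (restr u q1) (restr u q2)
  obtain ⟨η, hη, hη'⟩ := hH.exists_extension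
  obtain ⟨C, hC, hCb⟩ := exists_abs_le (hu.sub hη.1)
  obtain ⟨D, hD, hDb⟩ := exists_abs_le hh
  set f := restr u - restr η with hf
  have f1 : f q1 = 0 := by simp [hf, hη', harm]
  have f2 : f q2 = 0 := by simp [hf, hη', harm]
  have hbound : ∀ m, M ≤ m → graphEnergy m f ≤ C * (D + 1) := by
    intro m hm
    rw [← graphForm_self]
    nth_rw 1 [hf]
    rw [graphForm_sub_left, hη', graphForm_comm m (harm _ _), graphForm_harm, f1, f2, sub_self,
      zero_mul, sub_zero, graphForm_eq_neg_edgeMean m u f1 f2]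
    refine (neg_le_abs _).trans (abs_edgeMean_le m fun p hp => ?_)
    by_cases h0 : p ∈ V b 0
    · have : f p = 0 := by rcases h0 with rfl | rfl <;> assumption
      rw [this, zero_mul, abs_zero]
      positivity
    · rw [abs_mul]
      have h1 := abs_le.1 (hDb p)
      have h2 := abs_lt.1 (H m hm p ⟨hp, h0⟩)
      exact mul_le_mul (hCb p) (abs_le.2 ⟨by linarith, by linarith⟩) (abs_nonneg _) hC
  -- The bound holds only from level `M` on; monotonicity of the graph energies carries it to the
  -- lower levels.
  have hfin : FiniteEnergy f := (finiteEnergy_of_le fun ℓ =>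
    (graphEnergy_mono f (le_max_left ℓ M)).trans (hbound _ (le_max_right ℓ M))).1
  have := (hfin.add_sub hη.2).1
  rwa [hf, sub_add_cancel] at this

theorem HasLaplacian.of_uniform {b : ℕ} [NeZero b] {u h : BubbleDiamond b → ℝ}
    (hu : Continuous u) (hh : Continuous h) (H : ∀ ε : ℝ, 0 < ε → ∃ M : ℕ, ∀ m, M ≤ m →
      ∀ p ∈ V b m \ V b 0, |approxLaplacian m u p - h (p : BubbleDiamond b)| < ε) :
    HasLaplacian u h := by
  obtain ⟨M, hM⟩ := H 1 one_pos
  have hdom := MemDomE.of_uniform hu hh hM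
  refine ⟨hdom, hh, fun g hg g1 g2 => ?_⟩
  obtain ⟨C, hC, hCb⟩ := exists_abs_le hg.1
  have hlim := (tendsto_edgeMean (hh.mul hg.1)).neg
  refine tendsto_nhds_unique (tendsto_graphForm hdom.2 hg.2) ?_
  refine (tendsto_iff_of_dist ?_).2 hlim
  refine Metric.tendsto_atTop.2 fun ε hε => ?_
  -- The error is multiplied by `|g| ≤ C`; the `+ 1` allows `C = 0`.
  obtain ⟨N, hN⟩ := H (ε / (C + 1)) (by positivity)
  refine ⟨N, fun m hm => ?_⟩
  rw [graphForm_eq_neg_edgeMean m u g1 g2, Real.dist_0_eq_abs, abs_of_nonneg dist_nonneg,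
    dist_neg_neg, Real.dist_eq, ← edgeMean_sub]
  have hlt : C * (ε / (C + 1)) < ε := by
    rw [mul_div_assoc', div_lt_iff₀ (by positivity)]
    nlinarith
  refine (abs_edgeMean_le m fun p hp => ?_).trans_lt hlt
  have e : ((fun p => restr g p * approxLaplacian m u p) - restr fun x => h x * g x) p =
      g p * (approxLaplacian m u p - h p) := by
    simp only [Pi.sub_apply, restr]
    ring
  change |((fun p => restr g p * approxLaplacian m u p) - restr fun x => h x * g x) p| ≤ _
  rw [e]
  by_cases h0 : p ∈ V b 0
  · have : g p = 0 := by rcases h0 with rfl | rfl <;> assumption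
    rw [this, zero_mul, abs_zero]
    positivity
  · rw [abs_mul]
    exact mul_le_mul (hCb p) (hN m hm p ⟨hp, h0⟩).le (abs_nonneg _) hC

/-! ### Scaling -/

theorem HasLaplacian.comp_FK {b : ℕ} [NeZero b] {u h : BubbleDiamond b → ℝ}
    (hu : HasLaplacian u h) (i : Fin (b + 2)) :
    HasLaplacian (u ∘ FK i) (fun x => r b / ((b : ℝ) + 2) * h (FK i x)) := by
  classical
  have hui : FiniteEnergy (restr (u ∘ FK i)) := (restr_comp_FK u i).symm ▸ (hu.1.2.comp_F i).1
  refine ⟨⟨hu.1.1.comp (continuous_FK i), hui⟩,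
    continuous_const.mul (hu.2.1.comp (continuous_FK i)), fun g hg g1 g2 => ?_⟩
  -- The test function for `u` is `g` placed in the `i`-th cell and zero elsewhere; the pieces match
  -- on `V_1` because `g` vanishes at `q1` and `q2`.
  set φ : Fin (b + 2) → Vertex b → ℝ := fun j => if j = i then restr g else 0 with hφ
  have hGF : ∀ j, glue 0 φ ∘ F j = φ j := by
    intro j
    refine glue_comp_F ?_ ?_
    · by_cases hj : j = i
      · simpa [hφ, hj, restr] using g1
      · simp [hφ, hj]
    · by_cases hj : j = i
      · simpa [hφ, hj, restr] using g2
      · simp [hφ, hj]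
  have hform : ∀ (f : Vertex b → ℝ) (ℓ : ℕ),
      graphForm (ℓ + 1) f (glue 0 φ) = (r b)⁻¹ * graphForm ℓ (f ∘ F i) (restr g) := by
    intro f ℓ
    rw [graphForm_succ, Finset.sum_eq_single_of_mem i (Finset.mem_univ i)]
    · rw [hGF, hφ]
      simp only [if_true]
    · intro j _ hj
      rw [hGF, hφ]
      simp only [hj, if_false, graphForm_zero_right]
  have hfin : FiniteEnergy (glue 0 φ) := (finiteEnergy_of_le (C := (r b)⁻¹ * energy (restr g))
    fun ℓ => (graphEnergy_le_succ ℓ _).trans (by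
      rw [← graphForm_self, hform, hGF]
      simp only [hφ, if_true, graphForm_self]
      exact mul_le_mul_of_nonneg_left (hg.2.le ℓ) (inv_nonneg.2 (r_pos b).le))).1
  obtain ⟨γ, hγ, hγ'⟩ := hfin.exists_extension
  have key := hu.2.2 γ hγ (congrFun hγ' q1) (congrFun hγ' q2)
  -- Only the `i`-th cell contributes; the shift of one level accounts for the factor `1/r`.
  have e1 : energyForm (restr u) (restr γ) = (r b)⁻¹ * energyForm (restr (u ∘ FK i)) (restr g) := by
    rw [hγ']
    refine tendsto_nhds_unique ((tendsto_graphForm hu.1.2 hfin).comp (tendsto_add_atTop_nat 1)) ?_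
    refine ((tendsto_graphForm hui hg.2).const_mul _).congr fun ℓ => ?_
    rw [show restr (u ∘ FK i) = restr u ∘ F i from restr_comp_FK u i]
    exact (hform _ ℓ).symm
  have hγF : ∀ j x, γ (FK j x) = if j = i then g x else 0 := by
    intro j x
    refine UniformSpace.Completion.induction_on x (isClosed_eq (hγ.1.comp (continuous_FK j)) ?_) ?_
    · split_ifs
      · exact hg.1
      · exact continuous_const
    · intro p
      rw [FK_coe]
      change restr γ (F j p) = _
      rw [hγ']
      refine (congrFun (hGF j) p).trans ?_
      by_cases hj : j = i <;> simp [hφ, hj, restr]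
  rw [e1, integral_mu (φ := fun x => h x * γ x) (hu.2.1.mul hγ.1),
    Finset.sum_eq_single_of_mem i (Finset.mem_univ i)] at key
  · simp only [hγF, if_true] at key
    rw [inv_mul_eq_iff_eq_mul₀ (r_pos b).ne'] at key
    rw [key]
    simp only [mul_assoc, integral_const_mul]
    ring
  · intro j _ hj
    simp [hγF, hj]

end BubbleDiamond

theorem mainTheorem10 (b : ℕ) [NeZero b] :
    (∀ u h : BubbleDiamond b → ℝ, BubbleDiamond.HasLaplacian u h →
      ∀ p : BubbleDiamond.Vertex b, p ∉ BubbleDiamond.V b 0 →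
        Tendsto (fun m : ℕ => BubbleDiamond.approxLaplacian m u p) atTop
          (𝓝 (h (p : BubbleDiamond b)))) ∧
    (∀ u h : BubbleDiamond b → ℝ, Continuous u → Continuous h →
      (∀ ε : ℝ, 0 < ε → ∃ M : ℕ, ∀ m : ℕ, M ≤ m →
        ∀ p : BubbleDiamond.Vertex b, p ∈ BubbleDiamond.V b m \ BubbleDiamond.V b 0 →
          |BubbleDiamond.approxLaplacian m u p - h (p : BubbleDiamond b)| < ε) →
      BubbleDiamond.HasLaplacian u h) ∧
    (∀ (u h : BubbleDiamond b → ℝ) (i : Fin (b + 2)), BubbleDiamond.HasLaplacian u h →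
      BubbleDiamond.HasLaplacian (u ∘ BubbleDiamond.FK i)
        (fun x => BubbleDiamond.r b / ((b : ℝ) + 2) * h (BubbleDiamond.FK i x))) :=
  ⟨fun _ _ hu _ hp => hu.tendsto_approxLaplacian hp,
    fun _ _ hu hh H => BubbleDiamond.HasLaplacian.of_uniform hu hh H,
    fun _ _ i hu => hu.comp_FK i⟩
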